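/- Let $\mathcal{A}$ be an abelian category with derived category $D(\mathcal{A})$, and let $\mathcal{D}$ be the natural $t$-structure on $D(\mathcal{A})$ ($\mathcal{D}^{\le 0}$, resp. $\mathcal{D}^{\ge 0}$, consists of the complexes without cohomology in positive, resp. negative, degrees); its heart $\mathcal{H}_{\mathcal{D}}$ is identified with $\mathcal{A}$. Let $\mathcal{E}$ be a $2$-tilting torsion class in $\mathcal{A}$, i.e. a full subcategory such that: (1) every object of $\mathcal{A}$ is a subobject of an object of $\mathcal{E}$; (2) $\mathcal{E}$ is closed under extensions in $\mathcal{A}$; (3) the category $\mathcal{E}$ has kernels; (4) for every exact sequence $0\to K\to X_1\to X_2\to B\to 0$ in $\mathcal{A}$ with $X_1,X_2\in\mathcal{E}$ one has $B\in\mathcal{E}$. For full subcategories $\mathcal{U},\mathcal{V}$ of a triangulated category, let $\mathcal{U}\star\mathcal{V}$ be the full subcategory of the objects $X$ which fit in a distinguished triangle $U\to X\to V\to U[1]$ with $U\in\mathcal{U}$, $V\in\mathcal{V}$. Then there is a $t$-structure $\mathcal{T}$ on $D(\mathcal{A})$ with aisle $$\mathcal{T}^{\le 0}=\mathcal{D}^{\le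 -2}\star\mathcal{E}\star\mathcal{E}[1],$$ it satisfies $\mathcal{E}=\mathcal{H}_{\mathcal{D}}\cap\mathcal{H}_{\mathcal{T}}$, and $(\mathcal{D},\mathcal{T})$ is a $2$-tilting pair of $t$-structures on $\mathcal{C}=D(\mathcal{A})$, that is: (a) $\mathcal{D}^{\le -2}\subseteq\mathcal{T}^{\le 0}\subseteq\mathcal{D}^{\le 0}$; (b) every object of $\mathcal{H}_{\mathcal{D}}$ is a subobject of an object of $\mathcal{E}$, and every object of $\mathcal{H}_{\mathcal{T}}$ is a quotient of an object of $\mathcal{E}$; (c) a complex in $K(\mathcal{E})$ is acyclic in $\mathcal{H}_{\mathcal{D}}$ if and only if it is acyclic in $\mathcal{H}_{\mathcal{T}}$ and, with $\mathcal{N}\subseteq K(\mathcal{E})$ the full subcategory of these complexes, the canonical functors $K(\mathcal{E})\to D(\mathcal{H}_{\mathcal{D}})$ and $K(\mathcal{E})\to D(\mathcal{H}_{\mathcal{T}})$ induce equivalences $K(\mathcal{E})/\mathcal{N}\cong D(\mathcal{H}_{\mathcal{D}})$ and $K(\mathcal{E})/\mathcal{N}\cong D(\mathcal{H}_{\mathcal{T}})$;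 (d) there are triangulated equivalences $D(\mathcal{H}_{\mathcal{D}})\cong\mathcal{C}$ and $D(\mathcal{H}_{\mathcal{T}})\cong\mathcal{C}$ which extend the inclusions $\mathcal{H}_{\mathcal{D}}\subseteq\mathcal{C}$ and $\mathcal{H}_{\mathcal{T}}\subseteq\mathcal{C}$ and are compatible, up to natural isomorphism, with the functors from $K(\mathcal{E})$. -/

import Mathlib

open CategoryTheory Limits Pretriangulated Triangulated

universe w₂ w₁ w v u

/-- A full subcategory `E` of an abelian category `A` is a *2-tilting torsion class* if it
cogenerates `A`, is closed under extensions in `A`, has kernels (as a category on its own), and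
`B ∈ E` for every exact sequence `0 ⟶ K ⟶ X₁ ⟶ X₂ ⟶ B ⟶ 0` in `A` with `X₁, X₂ ∈ E`. -/
structure IsTwoTiltingTorsionClass {A : Type u} [Category.{v} A] [Abelian A]
    (E : ObjectProperty A) : Prop where
  cogenerates : ∀ X : A, ∃ (Y : A) (f : X ⟶ Y), E Y ∧ Mono f
  isClosedUnderExtensions : E.IsClosedUnderExtensions
  hasKernels : HasKernels E.FullSubcategory
  prop_of_exact : ∀ {K X₁ X₂ B : A} (f : K ⟶ X₁) (g : X₁ ⟶ X₂) (h : X₂ ⟶ B)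
    (w : f ≫ g = 0) (w' : g ≫ h = 0), Mono f → (ShortComplex.mk f g w).Exact →
    (ShortComplex.mk g h w').Exact → Epi h → E X₁ → E X₂ → E B

section Heart

variable {C : Type u} [Category.{v} C] [Preadditive C] [HasZeroObject C] [HasShift C ℤ]
  [∀ n : ℤ, (shiftFunctor C n).Additive] [Pretriangulated C]

instance heartContainsZero (t : TStructure C) : t.heart.ContainsZero where
  exists_zero := by
    obtain ⟨Z, hZ⟩ := HasZeroObject.zero (C := C)
    exact ⟨Z, hZ, (t.mem_heart_iff Z).2 ⟨t.isLE_of_isZero hZ 0, t.isGE_of_isZero hZ 0⟩⟩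

instance heartIsClosedUnderBinaryProducts (t : TStructure C) :
    t.heart.IsClosedUnderBinaryProducts := ⟨by
  rintro Z ⟨p⟩
  have e : Z ≅ p.diag.obj ⟨.left⟩ ⊞ p.diag.obj ⟨.right⟩ :=
    p.isLimit.conePointUniqueUpToIso
      ((IsLimit.postcomposeHomEquiv (diagramIsoPair p.diag).symm _).symm
        (BinaryBiproduct.isLimit (p.diag.obj ⟨.left⟩) (p.diag.obj ⟨.right⟩)))
  have h₁ := (t.mem_heart_iff _).1 (p.prop_diag_obj ⟨.left⟩)
  have h₂ := (t.mem_heart_iff _).1 (p.prop_diag_obj ⟨.right⟩)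
  have hT := binaryBiproductTriangle_distinguished
    (p.diag.obj ⟨.left⟩) (p.diag.obj ⟨.right⟩)
  exact t.heart.prop_of_iso e.symm ((t.mem_heart_iff _).2
    ⟨t.isLE₂ _ hT 0 h₁.1 h₂.1, t.isGE₂ _ hT 0 h₁.2 h₂.2⟩)⟩

theorem pretriangulated_hasFiniteProducts : HasFiniteProducts C :=
  hasFiniteProducts_of_has_binary_and_terminal

instance heartIsClosedUnderFiniteProducts (t : TStructure C) :
    t.heart.IsClosedUnderFiniteProducts := by
  have : HasFiniteProducts C := pretriangulated_hasFiniteProducts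
  exact .mk'

instance heartHasFiniteProducts (t : TStructure C) :
    HasFiniteProducts t.heart.FullSubcategory := by
  have : HasFiniteProducts C := pretriangulated_hasFiniteProducts
  infer_instance

/-- The intersection of the hearts of two t-structures. -/
def heartInter (D T : TStructure C) : ObjectProperty C := D.heart ⊓ T.heart

instance heartInterContainsZero (D T : TStructure C) : (heartInter D T).ContainsZero := by
  unfold heartInter; infer_instance

instance heartInterIsClosedUnderFiniteProducts (D T : TStructure C) :
    (heartInter D T).IsClosedUnderFiniteProducts := by
  have : (heartInter D T).IsClosedUnderBinaryProducts := ⟨by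
    rintro Z ⟨p⟩
    exact ⟨D.heart.prop_of_isLimit p.isLimit (fun j => (p.prop_diag_obj j).1),
      T.heart.prop_of_isLimit p.isLimit (fun j => (p.prop_diag_obj j).2)⟩⟩
  have : (heartInter D T).IsClosedUnderIsomorphisms := by
    unfold heartInter; infer_instance
  have : HasFiniteProducts C := pretriangulated_hasFiniteProducts
  exact .mk'

instance heartInterHasBinaryBiproducts (D T : TStructure C) :
    HasBinaryBiproducts (heartInter D T).FullSubcategory := by
  have : HasFiniteProducts C := pretriangulated_hasFiniteProducts
  exact HasBinaryBiproducts.of_hasBinaryProducts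

/-- The heart of a t-structure on a triangulated category is an abelian category. -/
noncomputable instance heartAbelian [IsTriangulated C] (t : TStructure C) :
    Abelian t.heart.FullSubcategory :=
  AbelianSubcategory.abelian t.heart.ι
    (by
      intro X Y n f hn
      have hX : t.IsLE X.obj 0 := ((t.mem_heart_iff _).1 X.2).1
      have hY : t.IsGE Y.obj 0 := ((t.mem_heart_iff _).1 Y.2).2
      have hY' : t.IsGE (Y.obj⟦n⟧) (-n) := t.isGE_shift Y.obj 0 n (-n)
      exact t.zero_of_isLE_of_isGE f 0 (-n) (by lia) hX hY')
    (by
      refine top_unique ?_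
      rintro X₁ X₂ f₁ - X₃ f₂ f₃ hT
      have h₁ := (t.mem_heart_iff _).1 X₁.2
      have h₂ := (t.mem_heart_iff _).1 X₂.2
      have : t.IsLE X₁.obj 0 := h₁.1
      have : t.IsGE X₁.obj 0 := h₁.2
      have : t.IsGE X₂.obj 0 := h₂.2
      have hT' := rot_of_distTriang _ hT
      have hL : t.IsLE (X₁.obj⟦(1 : ℤ)⟧) (-1) := t.isLE_shift X₁.obj 0 1 (-1)
      have hG : t.IsGE (X₁.obj⟦(1 : ℤ)⟧) (-1) := t.isGE_shift X₁.obj 0 1 (-1)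
      have : t.IsLE X₃ 0 := t.isLE₂ _ hT' 0 h₂.1 (t.isLE_of_le (X₁.obj⟦(1 : ℤ)⟧) (-1) 0)
      have : t.IsGE X₃ (-1) := t.isGE₂ _ hT' (-1) (t.isGE_of_ge X₂.obj (-1) 0) hG
      let e : (((t.truncLE (-1)).obj X₃)⟦(-1 : ℤ)⟧)⟦(1 : ℤ)⟧ ≅ (t.truncLE (-1)).obj X₃ :=
        (shiftFunctorCompIsoId C (-1 : ℤ) 1 (by simp)).app _
      have hK : t.heart (((t.truncLE (-1)).obj X₃)⟦(-1 : ℤ)⟧) := (t.mem_heart_iff _).2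
        ⟨t.isLE_shift _ (-1) (-1) 0, t.isGE_shift _ (-1) (-1) 0⟩
      have hQ : t.heart ((t.truncGE 0).obj X₃) := (t.mem_heart_iff _).2
        ⟨inferInstance, inferInstance⟩
      refine ⟨⟨_, hK⟩, ⟨_, hQ⟩, e.hom ≫ (t.truncLEι (-1)).app X₃, (t.truncGEπ 0).app X₃,
        (t.truncGEδLE (-1) 0 (by simp)).app X₃ ≫ e.inv⟦(1 : ℤ)⟧', ?_⟩
      refine isomorphic_distinguished _ (t.triangleLEGE_distinguished (-1) 0 (by simp) X₃) _ ?_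
      refine Triangle.isoMk _ _ e (Iso.refl _) (Iso.refl _) ?_ ?_ ?_
      · exact Category.comp_id _
      · exact (Category.comp_id _).trans (Category.id_comp _).symm
      · refine ((Category.assoc _ _ _).trans ?_).trans (Category.id_comp _).symm
        refine Eq.trans ?_ (Category.comp_id _)
        congr 1
        exact ((shiftFunctor C (1 : ℤ)).mapIso e).inv_hom_id)

/-- The inclusion of the intersection of the hearts of `D` and `T` in the heart of `D`. -/
abbrev heartInterToLeft (D T : TStructure C) :
    (heartInter D T).FullSubcategory ⥤ D.heart.FullSubcategory :=
  ObjectProperty.ιOfLE (P := heartInter D T) (P' := D.heart) inf_le_left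

/-- The inclusion of the intersection of the hearts of `D` and `T` in the heart of `T`. -/
abbrev heartInterToRight (D T : TStructure C) :
    (heartInter D T).FullSubcategory ⥤ T.heart.FullSubcategory :=
  ObjectProperty.ιOfLE (P := heartInter D T) (P' := T.heart) inf_le_right

instance heartInterToLeftAdditive (D T : TStructure C) : (heartInterToLeft D T).Additive where

instance heartInterToRightAdditive (D T : TStructure C) : (heartInterToRight D T).Additive where

end Heart

/-- The full subcategory of `K(E)` of the complexes which become acyclic in `B`, for an additive
functor `i : E ⥤ B` to an abelian category. -/
def acyclicAlong {E : Type*} [Category* E] [Preadditive E] {B : Type*} [Category* B] [Abelian B]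
    (i : E ⥤ B) [i.Additive] : ObjectProperty (HomotopyCategory E (ComplexShape.up ℤ)) :=
  (HomotopyCategory.subcategoryAcyclic B).inverseImage
    (i.mapHomotopyCategory (ComplexShape.up ℤ))

/-- The canonical functor `K(E) ⥤ K(B) ⥤ D(B)`, for an additive functor `i : E ⥤ B` to an abelian
category. -/
noncomputable def homotopyToDerived {E : Type*} [Category* E] [Preadditive E]
    {B : Type u} [Category.{v} B] [Abelian B] [HasDerivedCategory.{w} B]
    (i : E ⥤ B) [i.Additive] :
    HomotopyCategory E (ComplexShape.up ℤ) ⥤ DerivedCategory B :=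
  i.mapHomotopyCategory (ComplexShape.up ℤ) ⋙ DerivedCategory.Qh

section Tilting

variable {C : Type u} [Category.{v} C] [Preadditive C] [HasZeroObject C] [HasShift C ℤ]
  [∀ n : ℤ, (shiftFunctor C n).Additive] [Pretriangulated C] [IsTriangulated C]

/-- A triangulated equivalence `D(H_t) ≌ C` which extends the inclusion `H_t ⥤ C` of the heart
of a t-structure `t` on `C`. -/
structure HeartEquivalence (t : TStructure C)
    [HasDerivedCategory.{w} t.heart.FullSubcategory] where
  functor : DerivedCategory t.heart.FullSubcategory ⥤ C
  commShift : functor.CommShift ℤ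
  isTriangulated : functor.IsTriangulated
  isEquivalence : functor.IsEquivalence
  extendsInclusion : DerivedCategory.singleFunctor t.heart.FullSubcategory 0 ⋙ functor ≅ t.heart.ι

/-- A pair `(D, T)` of t-structures on a triangulated category `C` is *n-tilting* if
`D^{≤ -n} ⊆ T^{≤ 0} ⊆ D^{≤ 0}` and, for the intersection `E` of the hearts `H_D` and `H_T`:
`E` cogenerates `H_D`, `E` generates `H_T`, the complexes in `E` acyclic in `H_D` are those acyclic
in `H_T`, and with `N` the null system of these complexes in `K(E)`, one has triangulated
equivalences `C ≌ D(H_D) ≌ D(H_T) ≌ K(E)/N`.  That `K(E)/N ≌ D(H_D)` is expressed by saying that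
the canonical functor `K(E) ⥤ D(H_D)` is a localization functor for the class of morphisms of
`K(E)` with cone in `N`; similarly for `H_T`.  The equivalences `D(H_D) ≌ C` and `D(H_T) ≌ C` extend
the inclusions of the hearts, and are compatible with the functors from `K(E)`. -/
structure IsTiltingPair (n : ℕ) (D T : TStructure C)
    [HasDerivedCategory.{w₁} D.heart.FullSubcategory]
    [HasDerivedCategory.{w₂} T.heart.FullSubcategory] : Prop where
  le_neg_le : D.le (-(n : ℤ)) ≤ T.le 0
  le_zero_le : T.le 0 ≤ D.le 0
  cogenerates : ∀ X : D.heart.FullSubcategory, ∃ (Y : (heartInter D T).FullSubcategory)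
    (f : X ⟶ (heartInterToLeft D T).obj Y), Mono f
  generates : ∀ X : T.heart.FullSubcategory, ∃ (Y : (heartInter D T).FullSubcategory)
    (f : (heartInterToRight D T).obj Y ⟶ X), Epi f
  acyclic_iff : acyclicAlong (heartInterToLeft D T) = acyclicAlong (heartInterToRight D T)
  isLocalization_left : (homotopyToDerived (heartInterToLeft D T)).IsLocalization
    (acyclicAlong (heartInterToLeft D T)).trW
  isLocalization_right : (homotopyToDerived (heartInterToRight D T)).IsLocalization
    (acyclicAlong (heartInterToRight D T)).trW
  exists_equivalences : ∃ (F : HeartEquivalence D) (G : HeartEquivalence T),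
    Nonempty (homotopyToDerived (heartInterToLeft D T) ⋙ F.functor ≅
      homotopyToDerived (heartInterToRight D T) ⋙ G.functor)

end Tilting

/-- A full subcategory `E` of an abelian category `A`, seen as a full subcategory of `D(A)` (closed
under isomorphisms) through the functor which sends an object of `A` to the complex concentrated in
degree `0`. -/
noncomputable def inDerived {A : Type u} [Category.{v} A] [Abelian A] [HasDerivedCategory.{w} A]
    (E : ObjectProperty A) : ObjectProperty (DerivedCategory A) :=
  E.map (DerivedCategory.singleFunctor A 0)

/-! The class `E` plays two dual roles. In `A` it is coresolving: it cogenerates, and cokernels of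
maps of `E` stay in `E`. In the heart of the new t-structure it becomes resolving: it generates, and
kernels of maps of `E` stay in `E`.

Existence of the t-structure. By cogeneration an object `Z` of `A` is the kernel in `A` of a map of
`E`; the kernel of this map taken in `E` is a coreflection `K ⟶ Z`. As `E` is closed under
extensions, Wakamatsu's argument shows that the cone of `K ⟶ Z` receives no nonzero map from `E` or
`E[1]` (`tiltCoaisle_of_distinguished`). An object with cohomology in degrees -1 and 0 is a two-term
complex `Y ⟶ Z` with `Y` in `E`; factoring `Y ⟶ K ⟶ Z` splits off a part in `E ⋆ E[1]` with quotient
in the coaisle. Together with truncation this decomposes every object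
(`extensionProduct_tiltCoaisle`).

The new heart. An object of it lies in degrees `≤ 0`, so it is a complex with negative terms in `E`
and some `Z` in degree 0. The negative part lies in the aisle shifted by one, which forces `Z` into
`E` and makes `Z ⟶ X` epi (`prop_of_tiltAisle`, `exists_epi`). Since `E` generates, kernels computed
in `E` are kernels in the heart (`IsTwoTilting.isResolving`).

Derived categories. Two-step (co)resolutions replace any complex, even unbounded, by a
quasi-isomorphic one over `E`, so `K(E)` localizes to both derived categories. Acyclic complexes
over `E` splice into short exact sequences of objects of `E`, and in either heart these are the
distinguished triangles of the ambient category; hence both null systems agree (`acyclicAlong_eq`).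
This identifies the two derived categories. That the resulting functor restricts to the inclusion of
the new heart is checked on `E` and propagated along resolutions (`nonempty_heart_iso`). -/

namespace CategoryTheory

/-! ### Verdier localization restricted to a triangulated subcategory -/

namespace ObjectProperty

variable {C : Type*} [Category* C] [HasZeroObject C] [HasShift C ℤ] [Preadditive C]
  [∀ n : ℤ, (shiftFunctor C n).Additive] [Pretriangulated C] [IsTriangulated C]

/-- If `X ⟶ J ⟶ Y ⟶ X⟦1⟧` is distinguished with `J` in `S`, and `Y` maps to an object of `S` by a
morphism with cone in `N`, then so does `X`. -/
lemma exists_trW_to_of_distinguished (S N : ObjectProperty C) [S.IsTriangulated]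
    [N.IsTriangulated] {T : Triangle C} (hT : T ∈ distTriang C) (h₂ : S T.obj₂) {M : C}
    (s : T.obj₃ ⟶ M) (hs : N.trW s) (hM : S M) :
    ∃ (Y : C) (s' : T.obj₁ ⟶ Y), S Y ∧ N.trW s' := by
  rw [trW_iff'] at hs
  obtain ⟨Z, a, b, hZ, mem⟩ := hs
  obtain ⟨Y, hY, f, g, hY'⟩ := S.distinguished_cocone_triangle₁ (T.mor₂ ≫ s) h₂ hM
  have o := someOctahedron' rfl hT hZ hY'
  exact ⟨Y, o.m₁, hY, trW.mk _ o.mem mem⟩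

/-- If `Y ⟶ J ⟶ X ⟶ Y⟦1⟧` is distinguished with `J` in `S`, and an object of `S` maps to `Y` by a
morphism with cone in `N`, then so does `X`. -/
lemma exists_trW_from_of_distinguished (S N : ObjectProperty C) [S.IsTriangulated]
    [N.IsTriangulated] {T : Triangle C} (hT : T ∈ distTriang C) (h₂ : S T.obj₂) {M : C}
    (s : M ⟶ T.obj₁) (hs : N.trW s) (hM : S M) :
    ∃ (Y : C) (s' : Y ⟶ T.obj₃), S Y ∧ N.trW s' := by
  obtain ⟨Z, a, b, hZ, mem⟩ := hs
  obtain ⟨Y, hY, f, g, hY'⟩ := S.distinguished_cocone_triangle (s ≫ T.mor₁) hM h₂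
  have o := someOctahedron rfl hZ hT hY'
  exact ⟨Y, o.m₃, hY, trW.mk' _ o.mem mem⟩

omit [IsTriangulated C] in
lemma trW_inf_of_trW (S N : ObjectProperty C) [S.IsTriangulated]
    [N.IsTriangulated] [N.IsClosedUnderIsomorphisms] {X Y : C} (s : X ⟶ Y) (hX : S X) (hY : S Y)
    (hs : N.trW s) : (S ⊓ N).trW s := by
  obtain ⟨Z, hZ, f, g, hT⟩ := S.distinguished_cocone_triangle s hX hY
  exact ⟨Z, f, g, hT, hZ, (N.trW_iff_of_distinguished _ hT).1 hs⟩

/-- Composing a given `s : X ⟶ Y` with a map from `Y` into `S` gives a map between objects of `S`,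
whose cone lies in both `S` and `N`. -/
lemma isVerdierRightLocalizing_of_exists_trW (S N : ObjectProperty C) [S.IsTriangulated]
    [N.IsTriangulated] [N.IsClosedUnderIsomorphisms]
    (h : ∀ X : C, ∃ (Y : C) (s : X ⟶ Y), S Y ∧ N.trW s) : S.IsVerdierRightLocalizing N := by
  rw [isVerdierRightLocalizing_iff]
  intro X Y s hX hs
  obtain ⟨Z, t, hZ, ht⟩ := h Y
  exact ⟨Z, s ≫ t, t, hZ, trW_inf_of_trW _ _ _ hX hZ (N.trW.comp_mem _ _ hs ht), rfl⟩

lemma isVerdierLeftLocalizing_of_exists_trW (S N : ObjectProperty C) [S.IsTriangulated]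
    [N.IsTriangulated] [N.IsClosedUnderIsomorphisms]
    (h : ∀ X : C, ∃ (Y : C) (s : Y ⟶ X), S Y ∧ N.trW s) : S.IsVerdierLeftLocalizing N := by
  rw [isVerdierLeftLocalizing_iff]
  intro X Y s hY hs
  obtain ⟨Z, t, hZ, ht⟩ := h X
  exact ⟨Z, t ≫ s, t, hZ, trW_inf_of_trW _ _ _ hZ hY (N.trW.comp_mem _ _ ht hs), rfl⟩

omit [IsTriangulated C] in
-- The functor induced between the two localizations is fully faithful by assumption, and `h` makes
-- it essentially surjective; so both localizations are the same category.
lemma isLocalization_ι_comp {D : Type*} [Category* D] (S N : ObjectProperty C) [S.IsTriangulated]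
    [N.IsTriangulated] [N.IsClosedUnderIsomorphisms]
    [(S.triangulatedLocalizerMorphism N).IsLocalizedFullyFaithful]
    (L : C ⥤ D) [L.IsLocalization N.trW]
    (h : ∀ X : C, ∃ Y : C, S Y ∧ Nonempty (L.obj X ≅ L.obj Y)) :
    (S.ι ⋙ L).IsLocalization (N.inverseImage S.ι).trW := by
  let Φ := S.triangulatedLocalizerMorphism N
  let L₁ := (N.inverseImage S.ι).trW.Q
  let G := Φ.localizedFunctor L₁ L
  have e : S.ι ⋙ L ≅ L₁ ⋙ G := CatCommSq.iso Φ.functor L₁ L G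
  have : G.Full := Φ.full L₁ L G
  have : G.Faithful := Φ.faithful L₁ L G
  have : G.EssSurj := ⟨fun Z ↦ by
    have := Localization.essSurj L N.trW
    obtain ⟨Y, hY, ⟨e'⟩⟩ := h (L.objPreimage Z)
    exact ⟨L₁.obj ⟨Y, hY⟩, ⟨(e.app ⟨Y, hY⟩).symm ≪≫ e'.symm ≪≫ L.objObjPreimageIso Z⟩⟩⟩
  have : G.IsEquivalence := {}
  exact Functor.IsLocalization.of_equivalence_target L₁ _ (S.ι ⋙ L) G.asEquivalence e.symm

end ObjectProperty

section

variable {K C D : Type*} [Category* K] [Category* C] [Category* D]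
  [HasZeroObject C] [HasShift C ℤ] [Preadditive C]
  [∀ n : ℤ, (shiftFunctor C n).Additive] [Pretriangulated C] [CategoryTheory.IsTriangulated C]
  [HasZeroObject K] [HasShift K ℤ] [Preadditive K]
  [∀ n : ℤ, (shiftFunctor K n).Additive] [Pretriangulated K]
  (I : K ⥤ C) [I.CommShift ℤ] [I.IsTriangulated] [I.Full] [I.Faithful]
  (N : ObjectProperty C) [N.IsTriangulated] [N.IsClosedUnderIsomorphisms]
  (L : C ⥤ D) [L.IsLocalization N.trW]

omit [CategoryTheory.IsTriangulated C] in
-- Reduction to a full subcategory: `I` is an equivalence onto its essential image, and it matches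
-- the two classes of morphisms.
lemma Functor.isLocalization_comp_of_essImage
    [(I.essImage.triangulatedLocalizerMorphism N).IsLocalizedFullyFaithful]
    (h : ∀ X : C, ∃ Y : C, I.essImage Y ∧ Nonempty (L.obj X ≅ L.obj Y)) :
    (I ⋙ L).IsLocalization (N.inverseImage I).trW := by
  have := I.essImage.isLocalization_ι_comp N L h
  let Φ : LocalizerMorphism (N.inverseImage I).trW (N.inverseImage I.essImage.ι).trW :=
    { functor := I.toEssImage
      map := fun X Y f hf ↦ by
        rw [ObjectProperty.inverseImage_trW_iff] at hf
        rwa [MorphismProperty.inverseImage_iff, ObjectProperty.inverseImage_trW_iff] }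
  have : Φ.functor.IsEquivalence := inferInstanceAs I.toEssImage.IsEquivalence
  have : Φ.IsLocalizedEquivalence := by
    apply LocalizerMorphism.IsLocalizedEquivalence.of_equivalence
    intro X Y f hf
    let e := (Functor.mapArrow I.toEssImage).objObjPreimageIso (Arrow.mk f)
    refine ⟨_, _, ((Functor.mapArrow I.toEssImage).objPreimage (Arrow.mk f)).hom, ?_, ⟨e⟩⟩
    have hf' := ((N.inverseImage I.essImage.ι).trW.arrow_mk_iso_iff e).2 hf
    rw [ObjectProperty.inverseImage_trW_iff] at hf' ⊢
    exact hf'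
  have := LocalizerMorphism.IsLocalizedEquivalence.isLocalization Φ (I.essImage.ι ⋙ L)
  exact Functor.IsLocalization.of_iso (L₁ := Φ.functor ⋙ (I.essImage.ι ⋙ L)) _
    (Functor.isoWhiskerRight I.toEssImageCompι L)

/-- Let `I : K ⥤ C` be a fully faithful triangulated functor such that any object of `C` maps to
an object in the image of `I` by a morphism with cone in `N`. If `L` is a localization functor
with respect to `N`, then `I ⋙ L` is a localization functor. -/
lemma Functor.isLocalization_comp_of_exists_trW_to
    (h : ∀ X : C, ∃ (Y : C) (s : X ⟶ Y), I.essImage Y ∧ N.trW s) :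
    (I ⋙ L).IsLocalization (N.inverseImage I).trW := by
  have := ObjectProperty.isVerdierRightLocalizing_of_exists_trW _ _ h
  refine I.isLocalization_comp_of_essImage N L (fun X ↦ ?_)
  obtain ⟨Y, s, hY, hs⟩ := h X
  have := Localization.inverts L N.trW s hs
  exact ⟨Y, hY, ⟨asIso (L.map s)⟩⟩

/-- Let `I : K ⥤ C` be a fully faithful triangulated functor such that any object of `C` is the
target of a morphism with cone in `N` from an object in the image of `I`. If `L` is a
localization functor with respect to `N`, then `I ⋙ L` is a localization functor. -/
lemma Functor.isLocalization_comp_of_exists_trW_from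
    (h : ∀ X : C, ∃ (Y : C) (s : Y ⟶ X), I.essImage Y ∧ N.trW s) :
    (I ⋙ L).IsLocalization (N.inverseImage I).trW := by
  have := ObjectProperty.isVerdierLeftLocalizing_of_exists_trW _ _ h
  refine I.isLocalization_comp_of_essImage N L (fun X ↦ ?_)
  obtain ⟨Y, s, hY, hs⟩ := h X
  have := Localization.inverts L N.trW s hs
  exact ⟨Y, hY, ⟨(asIso (L.map s)).symm⟩⟩

end

end CategoryTheory

/-! ### Complexes over coresolving and resolving subcategories -/

namespace CategoryTheory

variable {E B : Type*} [Category* E] [Category* B] [Preadditive E] [Abelian B]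

/-- A functor `i : E ⥤ B` to an abelian category is coresolving if any object of `B` embeds in an
object of `E`, and if cokernels in `B` of morphisms of `E` belong to `E`. -/
structure IsCoresolving (i : E ⥤ B) [i.Additive] : Prop where
  exists_mono (X : B) : ∃ (Y : E) (f : X ⟶ i.obj Y), Mono f
  exists_cokernel {X Y : E} (f : X ⟶ Y) : ∃ (Z : E) (g : Y ⟶ Z) (w : i.map f ≫ i.map g = 0),
    (ShortComplex.mk _ _ w).Exact ∧ Epi (i.map g)

/-- A functor `i : E ⥤ B` to an abelian category is resolving if any object of `B` is a quotient
of an object of `E`, and if kernels in `B` of morphisms of `E` belong to `E`. -/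
structure IsResolving (i : E ⥤ B) [i.Additive] : Prop where
  exists_epi (X : B) : ∃ (Y : E) (f : i.obj Y ⟶ X), Epi f
  exists_kernel {X Y : E} (f : X ⟶ Y) : ∃ (Z : E) (g : Z ⟶ X) (w : i.map g ≫ i.map f = 0),
    (ShortComplex.mk _ _ w).Exact ∧ Mono (i.map g)

lemma mem_essImage_mapHomologicalComplex (i : E ⥤ B) [i.Additive] [i.Full] [i.Faithful]
    (K : CochainComplex B ℤ) (hK : ∀ n, i.essImage (K.X n)) :
    (i.mapHomologicalComplex (ComplexShape.up ℤ)).essImage K := by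
  let e (n : ℤ) : i.obj (hK n).witness ≅ K.X n := (hK n).getIso
  refine ⟨{ X := fun n ↦ (hK n).witness
            d := fun n m ↦ i.preimage ((e n).hom ≫ K.d n m ≫ (e m).inv)
            shape := fun n m h ↦ i.map_injective (by simp [K.shape _ _ h])
            d_comp_d' := fun n m k _ _ ↦ i.map_injective (by simp) }, ⟨?_⟩⟩
  refine HomologicalComplex.Hom.isoOfComponents e ?_
  intro n m _
  have h : i.map (i.preimage ((e n).hom ≫ K.d n m ≫ (e m).inv)) ≫ (e m).hom =
      (e n).hom ≫ K.d n m := by simp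
  exact h.symm

lemma mem_essImage_mapHomotopyCategory (i : E ⥤ B) [i.Additive] {K : CochainComplex B ℤ}
    (hK : (i.mapHomologicalComplex (ComplexShape.up ℤ)).essImage K) :
    (i.mapHomotopyCategory (ComplexShape.up ℤ)).essImage
      ((HomotopyCategory.quotient B (ComplexShape.up ℤ)).obj K) := by
  obtain ⟨L, ⟨e⟩⟩ := hK
  exact ⟨(HomotopyCategory.quotient _ _).obj L,
    ⟨(i.mapHomotopyCategoryFactors _).app L ≪≫ (HomotopyCategory.quotient _ _).mapIso e⟩⟩

section

variable [HasBinaryBiproducts E]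

/-- The contractible complex with term `e n ⊞ e (n + 1)` in degree `n`. -/
noncomputable abbrev discComplex (e : ℤ → E) : CochainComplex E ℤ :=
  CochainComplex.of (fun n ↦ e n ⊞ e (n + 1)) (fun _ ↦ biprod.snd ≫ biprod.inl) (by simp)

/-- The contractible complex with term `e (n - 1) ⊞ e n` in degree `n`. -/
noncomputable abbrev codiscComplex (e : ℤ → E) : CochainComplex E ℤ :=
  CochainComplex.of (fun n ↦ e (n - 1) ⊞ e n)
    (fun n ↦ biprod.snd ≫ eqToHom (by simp) ≫ biprod.inl) (by simp)

/-- Degreewise embeddings `ι n` need not commute with differentials. The pair `(ι n, d ≫ ι (n + 1))`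
does, with values in a disc complex, and it is mono because its first component is. -/
lemma exists_mono_mapHomologicalComplex (i : E ⥤ B) [i.Additive]
    (hi : ∀ X : B, ∃ (Y : E) (f : X ⟶ i.obj Y), Mono f) (K : CochainComplex B ℤ) :
    ∃ (J : CochainComplex E ℤ) (f : K ⟶ (i.mapHomologicalComplex _).obj J), Mono f := by
  choose e ι hι using fun n ↦ hi (K.X n)
  let φ (n : ℤ) : K.X n ⟶ i.obj (e n ⊞ e (n + 1)) :=
    ι n ≫ i.map biprod.inl + K.d n (n + 1) ≫ ι (n + 1) ≫ i.map biprod.inr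
  have hφ (n : ℤ) : φ n ≫ i.map ((discComplex e).d n (n + 1)) = K.d n (n + 1) ≫ φ (n + 1) := by
    have hd : (discComplex e).d n (n + 1) = biprod.snd ≫ biprod.inl :=
      CochainComplex.of_d (fun n ↦ e n ⊞ e (n + 1)) (fun _ ↦ biprod.snd ≫ biprod.inl) n
    refine (congrArg (fun x ↦ φ n ≫ i.map x) hd).trans ?_
    simp [φ, ← Functor.map_comp]
  have hφ' (n : ℤ) : φ n ≫ i.map biprod.fst = ι n := by
    simp [φ, ← Functor.map_comp]
  let f : K ⟶ (i.mapHomologicalComplex _).obj (discComplex e) :=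
    { f := φ
      comm' := by
        rintro n _ rfl
        exact hφ n }
  have (n : ℤ) : Mono (f.f n) := mono_of_mono_fac (hφ' n)
  exact ⟨_, f, HomologicalComplex.mono_of_mono_f f inferInstance⟩

/-- Dual to the embedding in a disc complex. The `eqToHom` in `codiscComplex` only identifies `e n`
with `e (n + 1 - 1)`. -/
lemma exists_epi_mapHomologicalComplex (i : E ⥤ B) [i.Additive]
    (hi : ∀ X : B, ∃ (Y : E) (f : i.obj Y ⟶ X), Epi f) (K : CochainComplex B ℤ) :
    ∃ (J : CochainComplex E ℤ) (f : (i.mapHomologicalComplex _).obj J ⟶ K), Epi f := by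
  choose e π hπ using fun n ↦ hi (K.X n)
  have hd {n m k : ℤ} (h : n = m) :
      i.map (eqToHom (congr_arg e h)) ≫ π m ≫ K.d m k = π n ≫ K.d n k := by
    subst h; simp
  let φ (n : ℤ) : i.obj (e (n - 1) ⊞ e n) ⟶ K.X n :=
    i.map biprod.snd ≫ π n + i.map biprod.fst ≫ π (n - 1) ≫ K.d (n - 1) n
  have hφ (n : ℤ) : φ n ≫ K.d n (n + 1) = i.map ((codiscComplex e).d n (n + 1)) ≫ φ (n + 1) := by
    have hd' : (codiscComplex e).d n (n + 1) = biprod.snd ≫ eqToHom (by simp) ≫ biprod.inl :=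
      CochainComplex.of_d (fun n ↦ e (n - 1) ⊞ e n)
        (fun n ↦ biprod.snd ≫ eqToHom (by simp) ≫ biprod.inl) n
    refine Eq.trans ?_ (congrArg (fun x ↦ i.map x ≫ φ (n + 1)) hd').symm
    simp only [φ, Preadditive.add_comp, Category.assoc, HomologicalComplex.d_comp_d, comp_zero,
      add_zero, Preadditive.comp_add, ← Functor.map_comp_assoc, biprod.inl_snd, biprod.inl_fst,
      Functor.map_zero, zero_comp, Category.comp_id, zero_add]
    rw [Functor.map_comp_assoc, hd (by simp)]
  have hφ' (n : ℤ) : i.map biprod.inr ≫ φ n = π n := by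
    simp [φ, ← Functor.map_comp_assoc]
  let f : (i.mapHomologicalComplex _).obj (codiscComplex e) ⟶ K :=
    { f := φ
      comm' := by
        rintro n _ rfl
        exact hφ n }
  have (n : ℤ) : Epi (f.f n) := epi_of_epi_fac (hφ' n)
  exact ⟨_, f, HomologicalComplex.epi_of_epi_f f inferInstance⟩

end

lemma trW_subcategoryAcyclic_quotient_map {K L : CochainComplex B ℤ} (f : K ⟶ L) [QuasiIso f] :
    (HomotopyCategory.subcategoryAcyclic B).trW
      ((HomotopyCategory.quotient B (ComplexShape.up ℤ)).map f) := by
  rw [← HomotopyCategory.quasiIso_eq_trW_subcategoryAcyclic,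
    HomotopyCategory.quotient_map_mem_quasiIso_iff]
  assumption

section

variable [HasZeroObject E] [HasBinaryBiproducts E]
  (i : E ⥤ B) [i.Additive] [i.Full] [i.Faithful]

/-- `S.X₃` is quasi-isomorphic to the mapping cone of `S.f`, which turns the short exact sequence
into a triangle of the homotopy category; the octahedral axiom then transfers a replacement from
`S.X₃` to `S.X₁`. -/
lemma exists_trW_to_of_shortExact {S : ShortComplex (CochainComplex B ℤ)} (hS : S.ShortExact)
    (h₂ : (i.mapHomologicalComplex _).essImage S.X₂)
    (h₃ : ∃ (M : HomotopyCategory B (ComplexShape.up ℤ))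
      (s : (HomotopyCategory.quotient _ _).obj S.X₃ ⟶ M),
      (i.mapHomotopyCategory _).essImage M ∧ (HomotopyCategory.subcategoryAcyclic B).trW s) :
    ∃ (M : HomotopyCategory B (ComplexShape.up ℤ))
      (s : (HomotopyCategory.quotient _ _).obj S.X₁ ⟶ M),
      (i.mapHomotopyCategory _).essImage M ∧ (HomotopyCategory.subcategoryAcyclic B).trW s := by
  obtain ⟨M, s, hM, hs⟩ := h₃
  have := CochainComplex.mappingCone.quasiIso_descShortComplex hS
  have hq := trW_subcategoryAcyclic_quotient_map (CochainComplex.mappingCone.descShortComplex S)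
  obtain ⟨Y, s', hY, hs'⟩ := ObjectProperty.exists_trW_to_of_distinguished
    (i.mapHomotopyCategory _).essImage (HomotopyCategory.subcategoryAcyclic B)
    (HomotopyCategory.mappingCone_triangleh_distinguished S.f)
    (mem_essImage_mapHomotopyCategory i h₂) _ (MorphismProperty.comp_mem _ _ _ hq hs) hM
  exact ⟨Y, s', hY, hs'⟩

lemma exists_trW_from_of_shortExact {S : ShortComplex (CochainComplex B ℤ)} (hS : S.ShortExact)
    (h₂ : (i.mapHomologicalComplex _).essImage S.X₂)
    (h₁ : ∃ (M : HomotopyCategory B (ComplexShape.up ℤ))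
      (s : M ⟶ (HomotopyCategory.quotient _ _).obj S.X₁),
      (i.mapHomotopyCategory _).essImage M ∧ (HomotopyCategory.subcategoryAcyclic B).trW s) :
    ∃ (M : HomotopyCategory B (ComplexShape.up ℤ))
      (s : M ⟶ (HomotopyCategory.quotient _ _).obj S.X₃),
      (i.mapHomotopyCategory _).essImage M ∧ (HomotopyCategory.subcategoryAcyclic B).trW s := by
  obtain ⟨M, s, hM, hs⟩ := h₁
  have := CochainComplex.mappingCone.quasiIso_descShortComplex hS
  have hq := trW_subcategoryAcyclic_quotient_map (CochainComplex.mappingCone.descShortComplex S)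
  obtain ⟨Y, s', hY, hs'⟩ := ObjectProperty.exists_trW_from_of_distinguished
    (i.mapHomotopyCategory _).essImage (HomotopyCategory.subcategoryAcyclic B)
    (HomotopyCategory.mappingCone_triangleh_distinguished S.f)
    (mem_essImage_mapHomotopyCategory i h₂) s hs hM
  exact ⟨Y, _, hY, MorphismProperty.comp_mem _ _ _ hs' hq⟩

variable {i}

omit [HasZeroObject E] [HasBinaryBiproducts E] in
lemma IsCoresolving.cokernel_mem_essImage (hi : IsCoresolving i) {J L : CochainComplex E ℤ}
    (f : (i.mapHomologicalComplex (ComplexShape.up ℤ)).obj J ⟶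
      (i.mapHomologicalComplex (ComplexShape.up ℤ)).obj L) :
    (i.mapHomologicalComplex _).essImage (cokernel f) := by
  apply mem_essImage_mapHomologicalComplex
  intro n
  obtain ⟨Z, g, w, hg, _⟩ := hi.exists_cokernel (i.preimage (f.f n))
  refine ⟨Z, ⟨?_⟩⟩
  let e : (cokernel f).X n ≅ cokernel (f.f n) :=
    PreservesCokernel.iso (HomologicalComplex.eval B (ComplexShape.up ℤ) n) f
  exact IsColimit.coconePointUniqueUpToIso hg.gIsCokernel (cokernelIsCokernel (i.map (i.preimage (f.f n)))) ≪≫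
    cokernelIsoOfEq (i.map_preimage (X := J.X n) (Y := L.X n) (f.f n)) ≪≫ e.symm

omit [HasZeroObject E] [HasBinaryBiproducts E] in
lemma IsResolving.kernel_mem_essImage (hi : IsResolving i) {J L : CochainComplex E ℤ}
    (f : (i.mapHomologicalComplex (ComplexShape.up ℤ)).obj J ⟶
      (i.mapHomologicalComplex (ComplexShape.up ℤ)).obj L) :
    (i.mapHomologicalComplex _).essImage (kernel f) := by
  apply mem_essImage_mapHomologicalComplex
  intro n
  obtain ⟨Z, g, w, hg, _⟩ := hi.exists_kernel (i.preimage (f.f n))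
  refine ⟨Z, ⟨?_⟩⟩
  let e : (kernel f).X n ≅ kernel (f.f n) :=
    PreservesKernel.iso (HomologicalComplex.eval B (ComplexShape.up ℤ) n) f
  exact IsLimit.conePointUniqueUpToIso hg.fIsKernel (kernelIsKernel (i.map (i.preimage (f.f n)))) ≪≫
    kernelIsoOfEq (i.map_preimage (X := J.X n) (Y := L.X n) (f.f n)) ≪≫ e.symm

/-- Two embeddings suffice: for `K ↪ J₀` and `J₀/K ↪ J₁`, the last quotient is the cokernel of `J₀ ⟶
J₁`, whose terms are already in `E`. This uniform bound on the coresolution is what allows unbounded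
complexes. -/
lemma IsCoresolving.exists_trW_to (hi : IsCoresolving i)
    (X : HomotopyCategory B (ComplexShape.up ℤ)) :
    ∃ (M : HomotopyCategory B (ComplexShape.up ℤ)) (s : X ⟶ M),
      (i.mapHomotopyCategory _).essImage M ∧ (HomotopyCategory.subcategoryAcyclic B).trW s := by
  obtain ⟨K, rfl⟩ := HomotopyCategory.quotient_obj_surjective X
  obtain ⟨J₀, f₀, _⟩ := exists_mono_mapHomologicalComplex i hi.exists_mono K
  obtain ⟨J₁, f₁, _⟩ := exists_mono_mapHomologicalComplex i hi.exists_mono (cokernel f₀)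
  have h₀ : (ShortComplex.mk f₀ (cokernel.π f₀) (by simp)).ShortExact :=
    { exact := ShortComplex.exact_cokernel f₀ }
  have h₁ : (ShortComplex.mk f₁ (cokernel.π f₁) (by simp)).ShortExact :=
    { exact := ShortComplex.exact_cokernel f₁ }
  refine exists_trW_to_of_shortExact i h₀ (Functor.obj_mem_essImage _ _) ?_
  refine exists_trW_to_of_shortExact i h₁ (Functor.obj_mem_essImage _ _) ?_
  refine ⟨_, 𝟙 _, mem_essImage_mapHomotopyCategory i ?_, MorphismProperty.id_mem _ _⟩
  refine Functor.essImage.ofIso ?_ (hi.cokernel_mem_essImage (cokernel.π f₀ ≫ f₁))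
  exact cokernelEpiComp _ _

lemma IsResolving.exists_trW_from (hi : IsResolving i)
    (X : HomotopyCategory B (ComplexShape.up ℤ)) :
    ∃ (M : HomotopyCategory B (ComplexShape.up ℤ)) (s : M ⟶ X),
      (i.mapHomotopyCategory _).essImage M ∧ (HomotopyCategory.subcategoryAcyclic B).trW s := by
  obtain ⟨K, rfl⟩ := HomotopyCategory.quotient_obj_surjective X
  obtain ⟨J₀, f₀, _⟩ := exists_epi_mapHomologicalComplex i hi.exists_epi K
  obtain ⟨J₁, f₁, _⟩ := exists_epi_mapHomologicalComplex i hi.exists_epi (kernel f₀)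
  have h₀ : (ShortComplex.mk (kernel.ι f₀) f₀ (by simp)).ShortExact :=
    { exact := ShortComplex.exact_kernel f₀ }
  have h₁ : (ShortComplex.mk (kernel.ι f₁) f₁ (by simp)).ShortExact :=
    { exact := ShortComplex.exact_kernel f₁ }
  refine exists_trW_from_of_shortExact i h₀ (Functor.obj_mem_essImage _ _) ?_
  refine exists_trW_from_of_shortExact i h₁ (Functor.obj_mem_essImage _ _) ?_
  refine ⟨_, 𝟙 _, mem_essImage_mapHomotopyCategory i ?_, MorphismProperty.id_mem _ _⟩
  refine Functor.essImage.ofIso ?_ (hi.kernel_mem_essImage (f₁ ≫ kernel.ι f₀))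
  exact kernelCompMono _ _

end

section

variable {E : Type*} {B : Type u} [Category* E] [Category.{v} B] [Preadditive E] [Abelian B]
  [HasDerivedCategory.{w} B] [HasZeroObject E] [HasBinaryBiproducts E]
  {i : E ⥤ B} [i.Additive] [i.Full] [i.Faithful]

/-- If `i : E ⥤ B` is coresolving, then `K(E) ⥤ D(B)` is a localization functor. -/
lemma IsCoresolving.isLocalization_homotopyToDerived (hi : IsCoresolving i) :
    (homotopyToDerived i).IsLocalization (acyclicAlong i).trW :=
  Functor.isLocalization_comp_of_exists_trW_to _ _ _ hi.exists_trW_to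

/-- If `i : E ⥤ B` is resolving, then `K(E) ⥤ D(B)` is a localization functor. -/
lemma IsResolving.isLocalization_homotopyToDerived (hi : IsResolving i) :
    (homotopyToDerived i).IsLocalization (acyclicAlong i).trW :=
  Functor.isLocalization_comp_of_exists_trW_from _ _ _ hi.exists_trW_from

/-- If `i : E ⥤ B` is coresolving, any object of `D(B)` is represented by a complex in `E`. -/
lemma IsCoresolving.exists_iso_Q_obj (hi : IsCoresolving i) (X : DerivedCategory B) :
    ∃ Y : CochainComplex E ℤ,
      Nonempty (X ≅ DerivedCategory.Q.obj ((i.mapHomologicalComplex _).obj Y)) := by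
  obtain ⟨M, s, ⟨Y, ⟨e⟩⟩, hs⟩ := hi.exists_trW_to (DerivedCategory.Qh.objPreimage X)
  have := Localization.inverts DerivedCategory.Qh _ _ hs
  obtain ⟨Y, rfl⟩ := HomotopyCategory.quotient_obj_surjective Y
  exact ⟨Y, ⟨(DerivedCategory.Qh.objObjPreimageIso X).symm ≪≫ asIso (DerivedCategory.Qh.map s) ≪≫
    DerivedCategory.Qh.mapIso (e.symm ≪≫ (i.mapHomotopyCategoryFactors _).app Y) ≪≫
    (DerivedCategory.quotientCompQhIso B).app _⟩⟩

end

end CategoryTheory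

/-! ### The tilted t-structure, in a general triangulated category -/

namespace CategoryTheory.Triangulated

variable {C : Type*} [Category* C] [Preadditive C] [HasZeroObject C] [HasShift C ℤ]
  [∀ n : ℤ, (shiftFunctor C n).Additive] [Pretriangulated C]

/-- Properties of a full subcategory `P` of the heart of a t-structure `t` which allow to tilt
`t` twice with respect to `P`. -/
structure IsTwoTilting (t : TStructure C) (P : ObjectProperty C) : Prop where
  isClosedUnderIsomorphisms : P.IsClosedUnderIsomorphisms
  le_heart : P ≤ t.heart
  isTriangulatedClosed₂ : P.IsTriangulatedClosed₂
  exists_coreflection (Z : C) (hZ : t.heart Z) : ∃ (K : C) (c : K ⟶ Z), P K ∧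
    ∀ X, P X → Function.Bijective (fun f : X ⟶ K ↦ f ≫ c)
  exists_triangle (X : C) (_ : t.IsGE X (-1)) (_ : t.IsLE X 0) :
    ∃ (Z Y : C) (f : Z ⟶ X) (g : X ⟶ Y⟦(1 : ℤ)⟧) (h : Y⟦(1 : ℤ)⟧ ⟶ Z⟦(1 : ℤ)⟧),
      Triangle.mk f g h ∈ distTriang C ∧ t.heart Z ∧ P Y
  prop_of_distinguished {T : Triangle C} (hT : T ∈ distTriang C) (h₁ : P T.obj₁) (h₂ : P T.obj₂)
    (h₃ : t.heart T.obj₃) : P T.obj₃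

/-- The objects `≥ -1` which receive no nonzero morphism from `P` and `P[1]`. -/
def tiltCoaisle (t : TStructure C) (P : ObjectProperty C) : ObjectProperty C :=
  t.ge (-1) ⊓ (P.rightOrthogonal ⊓ (P.map (shiftFunctor C (1 : ℤ))).rightOrthogonal)

/-- The objects which have no nonzero morphism to an object in `tiltCoaisle t P`. -/
def tiltAisle (t : TStructure C) (P : ObjectProperty C) : ObjectProperty C :=
  (tiltCoaisle t P).leftOrthogonal

variable {t : TStructure C} {P : ObjectProperty C}

instance (t : TStructure C) (n : ℤ) : (t.ge n).IsTriangulatedClosed₂ :=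
  .mk' (fun T hT h₁ h₃ ↦ by
    rw [TStructure.ge_iff_isGE] at *
    exact t.isGE₂ T hT n h₁ h₃)

instance (t : TStructure C) (n : ℤ) : (t.le n).IsTriangulatedClosed₂ :=
  .mk' (fun T hT h₁ h₃ ↦ by
    rw [TStructure.le_iff_isLE] at *
    exact t.isLE₂ T hT n h₁ h₃)

instance : (tiltCoaisle t P).IsTriangulatedClosed₂ := by
  unfold tiltCoaisle; infer_instance

instance : (tiltCoaisle t P).IsClosedUnderIsomorphisms := by
  unfold tiltCoaisle; infer_instance

instance : (tiltAisle t P).IsTriangulatedClosed₂ := by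
  unfold tiltAisle; infer_instance

instance : (tiltAisle t P).IsClosedUnderIsomorphisms := by
  unfold tiltAisle; infer_instance

section

variable {X Y Z : C} {f : X ⟶ Y} {g : Y ⟶ Z} {h : Z ⟶ X⟦(1 : ℤ)⟧}
  (hT : Triangle.mk f g h ∈ distTriang C)

include hT

lemma mk_coyoneda₂ {W : C} (x : W ⟶ Y) (hx : x ≫ g = 0) : ∃ y : W ⟶ X, x = y ≫ f :=
  Triangle.coyoneda_exact₂ _ hT x hx

lemma mk_coyoneda₃ {W : C} (x : W ⟶ Z) (hx : x ≫ h = 0) : ∃ y : W ⟶ Y, x = y ≫ g :=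
  Triangle.coyoneda_exact₃ _ hT x hx

lemma mk_yoneda₂ {W : C} (x : Y ⟶ W) (hx : f ≫ x = 0) : ∃ y : Z ⟶ W, x = g ≫ y :=
  Triangle.yoneda_exact₂ _ hT x hx

lemma mk_yoneda₃ {W : C} (x : Z ⟶ W) (hx : g ≫ x = 0) : ∃ y : X⟦(1 : ℤ)⟧ ⟶ W, x = h ≫ y :=
  Triangle.yoneda_exact₃ _ hT x hx

lemma mk_zero₁₂ : f ≫ g = 0 := comp_distTriang_mor_zero₁₂ _ hT

lemma mk_zero₃₁ : h ≫ f⟦(1 : ℤ)⟧' = 0 := comp_distTriang_mor_zero₃₁ _ hT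

lemma mk_exists_hom₂ {X' Y' Z' : C} {f' : X' ⟶ Y'} {g' : Y' ⟶ Z'} {h' : Z' ⟶ X'⟦(1 : ℤ)⟧}
    (hT' : Triangle.mk f' g' h' ∈ distTriang C) (a : X ⟶ X') (c : Z ⟶ Z')
    (comm : h ≫ a⟦(1 : ℤ)⟧' = c ≫ h') : ∃ b : Y ⟶ Y', f ≫ b = a ≫ f' ∧ g ≫ c = b ≫ g' :=
  complete_distinguished_triangle_morphism₂ _ _ hT hT' a c comm

lemma mk_of_iso {X' Y' Z' : C} {f' : X' ⟶ Y'} {g' : Y' ⟶ Z'} {h' : Z' ⟶ X'⟦(1 : ℤ)⟧}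
    (a : X ≅ X') (b : Y ≅ Y') (c : Z ≅ Z') (h₁ : f ≫ b.hom = a.hom ≫ f')
    (h₂ : g ≫ c.hom = b.hom ≫ g') (h₃ : h ≫ a.hom⟦(1 : ℤ)⟧' = c.hom ≫ h') :
    Triangle.mk f' g' h' ∈ distTriang C :=
  isomorphic_distinguished _ hT _ (Triangle.isoMk _ _ a b c h₁ h₂ h₃).symm

lemma mk_rotate : Triangle.mk g h (-f⟦(1 : ℤ)⟧') ∈ distTriang C := rot_of_distTriang _ hT

end

lemma mk_of_rotate {X Y Z : C} {f : X ⟶ Y} {g : Y ⟶ Z} {h : Z ⟶ X⟦(1 : ℤ)⟧}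
    (hT : Triangle.mk g h (-f⟦(1 : ℤ)⟧') ∈ distTriang C) : Triangle.mk f g h ∈ distTriang C :=
  (rotate_distinguished_triangle _).2 hT

omit [HasZeroObject C] [Pretriangulated C] in
lemma shift_hom_eq_zero {X Y : C} (n : ℤ) (h : ∀ f : X ⟶ Y, f = 0) (f : X⟦n⟧ ⟶ Y⟦n⟧) :
    f = 0 := by
  obtain ⟨g, rfl⟩ := (shiftFunctor C n).map_surjective f
  rw [h g, Functor.map_zero]

omit [HasZeroObject C] [Pretriangulated C] in
lemma shift_hom_eq_zero' {X Y : C} (n m : ℤ) (hnm : n + m = 0) (h : ∀ f : X⟦n⟧ ⟶ Y, f = 0)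
    (f : X ⟶ Y⟦m⟧) : f = 0 := by
  let e : X⟦n⟧⟦m⟧ ≅ X := (shiftFunctorCompIsoId C n m hnm).app X
  rw [← cancel_epi e.hom, comp_zero]
  exact shift_hom_eq_zero m h _

namespace IsTwoTilting

lemma isLE (hP : IsTwoTilting t P) {X : C} (hX : P X) : t.IsLE X 0 :=
  ((t.mem_heart_iff _).1 (hP.le_heart _ hX)).1

lemma isGE (hP : IsTwoTilting t P) {X : C} (hX : P X) : t.IsGE X 0 :=
  ((t.mem_heart_iff _).1 (hP.le_heart _ hX)).2

lemma tiltCoaisle_iff (V : C) : tiltCoaisle t P V ↔ t.IsGE V (-1) ∧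
    (∀ X, P X → ∀ f : X ⟶ V, f = 0) ∧ ∀ X, P X → ∀ f : X⟦(1 : ℤ)⟧ ⟶ V, f = 0 := by
  simp only [tiltCoaisle, ObjectProperty.prop_inf_iff, TStructure.ge_iff_isGE]
  refine and_congr Iff.rfl (and_congr ⟨fun h X hX f ↦ h f hX, fun h X f hX ↦ h X hX f⟩
    ⟨fun h X hX f ↦ h f ⟨X, hX, ⟨Iso.refl _⟩⟩, ?_⟩)
  rintro h X f ⟨Y, hY, ⟨e⟩⟩
  rw [← cancel_epi e.hom, comp_zero]
  exact h Y hY _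

/-- Maps `X ⟶ V[-1]` are maps `X[1] ⟶ V`, and maps `X[1] ⟶ V[-1]` vanish for degree reasons since
`V[-1]` is `≥ 0`. -/
lemma tiltCoaisle_shift_neg_one (hP : IsTwoTilting t P) {V : C} (hV : tiltCoaisle t P V) :
    tiltCoaisle t P (V⟦(-1 : ℤ)⟧) := by
  rw [tiltCoaisle_iff] at hV ⊢
  obtain ⟨h₁, h₂, h₃⟩ := hV
  have h₄ : t.IsGE (V⟦(-1 : ℤ)⟧) 0 := t.isGE_shift V (-1) (-1) 0
  refine ⟨t.isGE_of_ge _ (-1) 0, fun X hX f ↦ shift_hom_eq_zero' 1 (-1) (by simp) (h₃ X hX) f,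
    fun X hX f ↦ ?_⟩
  have := hP.isLE hX
  have := t.isLE_shift X 0 1 (-1)
  exact t.zero f (-1) 0

lemma tiltAisle_shift_one (hP : IsTwoTilting t P) {U : C} (hU : tiltAisle t P U) :
    tiltAisle t P (U⟦(1 : ℤ)⟧) := by
  intro V f hV
  have h := hU (Y := V⟦(-1 : ℤ)⟧)
  let e : V⟦(-1 : ℤ)⟧⟦(1 : ℤ)⟧ ≅ V := (shiftFunctorCompIsoId C (-1 : ℤ) 1 (by simp)).app V
  rw [← cancel_mono e.inv, zero_comp]
  exact shift_hom_eq_zero 1 (fun g ↦ h g (hP.tiltCoaisle_shift_neg_one hV)) _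

lemma tiltCoaisle_of_isGE_one (hP : IsTwoTilting t P) (V : C) [t.IsGE V 1] :
    tiltCoaisle t P V := by
  rw [tiltCoaisle_iff]
  refine ⟨t.isGE_of_ge V (-1) 1, fun X hX f ↦ ?_, fun X hX f ↦ ?_⟩
  · have := hP.isLE hX
    exact t.zero f 0 1
  · have := hP.isLE hX
    have := t.isLE_shift X 0 1 (-1)
    exact t.zero f (-1) 1

lemma le_tiltAisle : P ≤ tiltAisle t P := fun _ hX _ f hV ↦ ((tiltCoaisle_iff _).1 hV).2.1 _ hX f

lemma map_shift_le_tiltAisle : P.map (shiftFunctor C (1 : ℤ)) ≤ tiltAisle t P :=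
  fun _ hX _ f hV ↦ hV.2.2 f hX

lemma le_neg_two_le_tiltAisle : t.le (-2) ≤ tiltAisle t P := fun X hX V f hV ↦ by
  have : t.IsLE X (-2) := ⟨hX⟩
  have := ((tiltCoaisle_iff _).1 hV).1
  exact t.zero f (-2) (-1)

/-- The cone of a coreflection belongs to the coaisle. -/
lemma tiltCoaisle_of_distinguished (hP : IsTwoTilting t P) {K Z V : C} {c : K ⟶ Z} {g : Z ⟶ V}
    {δ : V ⟶ K⟦(1 : ℤ)⟧} (hT : Triangle.mk c g δ ∈ distTriang C) (hK : P K) (hZ : t.heart Z)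
    (hc : ∀ X, P X → Function.Bijective (fun f : X ⟶ K ↦ f ≫ c)) :
    tiltCoaisle t P V := by
  have hcg : c ≫ g = 0 := mk_zero₁₂ hT
  have := hP.isGE hK
  have := hP.isLE hK
  obtain ⟨_, _⟩ := (t.mem_heart_iff _).1 hZ
  rw [tiltCoaisle_iff]
  refine ⟨t.isGE₂ _ (rot_of_distTriang _ hT) (-1) (t.isGE_of_ge Z (-1) 0)
    (t.isGE_shift K 0 1 (-1)), fun X hX f ↦ ?_, fun X hX f ↦ ?_⟩
  -- Wakamatsu's argument: `f ≫ δ` classifies an extension `Y` of `X` by `K`, which lies in `P`. It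
  -- maps to `Z` extending `c`; the lift of this map to `K` splits the extension, so `f ≫ δ = 0`.
  -- Then `f` comes from a map `X ⟶ Z`, which factors through `c` and dies in `V`.
  · obtain ⟨Y, a, b, hY⟩ := distinguished_cocone_triangle₂ (f ≫ δ)
    have hPY : P Y := by
      have := hP.isTriangulatedClosed₂
      have := hP.isClosedUnderIsomorphisms
      exact P.ext_of_isTriangulatedClosed₂ _ hY hK hX
    obtain ⟨φ, hφ, -⟩ := mk_exists_hom₂ hY hT (𝟙 K) f (by rw [Functor.map_id, Category.comp_id])
    obtain ⟨r, hr : r ≫ c = φ⟩ := (hc Y hPY).2 φ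
    have har : a ≫ r = 𝟙 K := (hc K hK).1 (by
      dsimp
      rw [Category.assoc, hr, hφ])
    have hδ : f ≫ δ = 0 := by
      have h₀ := mk_zero₃₁ hY
      have h₁ : a⟦(1 : ℤ)⟧' ≫ r⟦(1 : ℤ)⟧' = 𝟙 (K⟦(1 : ℤ)⟧) := by
        rw [← Functor.map_comp, har, Functor.map_id]
      rw [← Category.comp_id (f ≫ δ), ← h₁, ← Category.assoc, h₀, zero_comp]
    obtain ⟨z, hz⟩ := mk_coyoneda₃ hT f hδ
    obtain ⟨k, rfl⟩ := (hc X hX).2 z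
    rw [hz, Category.assoc, hcg, comp_zero]
  -- Here `f ≫ δ` is the shift of a map `x : X ⟶ K` killed by `c`, hence zero by injectivity of the
  -- coreflection; what remains is a map `X[1] ⟶ Z`, zero for degree reasons.
  · have := hP.isLE hX
    have := t.isLE_shift X 0 1 (-1)
    obtain ⟨x, hx⟩ := (shiftFunctor C (1 : ℤ)).map_surjective (f ≫ δ)
    have hδ : f ≫ δ = 0 := by
      rw [← hx]
      have h₀ : (f ≫ δ) ≫ c⟦(1 : ℤ)⟧' = 0 := by
        rw [Category.assoc, mk_zero₃₁ hT, comp_zero]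
      have h₁ : x ≫ c = 0 := (shiftFunctor C (1 : ℤ)).map_injective (by
        rw [Functor.map_comp, hx, h₀, Functor.map_zero])
      rw [(hc X hX).1 (h₁.trans zero_comp.symm), Functor.map_zero]
    obtain ⟨z, hz⟩ := mk_coyoneda₃ hT f hδ
    rw [hz, t.zero z (-1) 0, zero_comp]

variable [CategoryTheory.IsTriangulated C]

/-- `X` is the cone of a map `Y ⟶ Z` with `Y` in `P`, which factors through the coreflection `K ⟶
Z`. By the octahedral axiom the cone `U` of `Y ⟶ K` maps to `X`, with the cone `V` of `K ⟶ Z` as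
third vertex. -/
lemma extensionProduct_of_isGE_of_isLE (hP : IsTwoTilting t P) (X : C) (h₁ : t.IsGE X (-1))
    (h₀ : t.IsLE X 0) :
    ((P.extensionProduct (P.map (shiftFunctor C (1 : ℤ)))).extensionProduct (tiltCoaisle t P)) X := by
  obtain ⟨Z, Y, f, g, h, hT, hZ, hY⟩ := hP.exists_triangle X h₁ h₀
  obtain ⟨K, c, hK, hc⟩ := hP.exists_coreflection Z hZ
  obtain ⟨V, d, δ, hV⟩ := distinguished_cocone_triangle c
  obtain ⟨h', rfl⟩ := (shiftFunctor C (1 : ℤ)).map_surjective h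
  obtain ⟨k, rfl⟩ := (hc Y hY).2 h'
  obtain ⟨U, a, b, hU⟩ := distinguished_cocone_triangle₂ (-k⟦(1 : ℤ)⟧')
  -- Rotating the triangle on `c` twice produces `-c[1]`; the sign on `k[1]` compensates, so that
  -- the composite is the given connecting map.
  have o := someOctahedron' (u₁₂ := -k⟦(1 : ℤ)⟧') (u₂₃ := -c⟦(1 : ℤ)⟧')
    (by simp) (rot_of_distTriang _ hU) (rot_of_distTriang _ (rot_of_distTriang _ hV))
    (rot_of_distTriang _ hT)
  exact ⟨U, V, _, _, _, o.mem, ⟨K, _, _, _, _, hU, hK, ⟨Y, hY, ⟨Iso.refl _⟩⟩⟩,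
    hP.tiltCoaisle_of_distinguished hV hK hZ hc⟩

/-- Truncation cuts `X` into degrees `≤ -2`, `[-1, 0]` and `≥ 1`. The last part is in the coaisle,
the middle one has just been decomposed, and associativity of `⋆` with extension-closure of the
coaisle regroups the pieces. -/
lemma extensionProduct_tiltCoaisle (hP : IsTwoTilting t P) (X : C) :
    ((((t.le (-2)).extensionProduct P).extensionProduct
      (P.map (shiftFunctor C (1 : ℤ)))).extensionProduct (tiltCoaisle t P)) X := by
  obtain ⟨W, X', hW, hX', f, g, h, hT⟩ := t.exists_triangle X (-2) (-1) (by simp)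
  obtain ⟨X₀, X₁, hX₀, hX₁, f', g', h', hT'⟩ := t.exists_triangle X' 0 1 (by simp)
  have : t.IsLE W (-2) := ⟨hW⟩
  have : t.IsGE X' (-1) := ⟨hX'⟩
  have : t.IsLE X₀ 0 := ⟨hX₀⟩
  have : t.IsGE X₁ 1 := ⟨hX₁⟩
  have hX₀' : t.IsGE X₀ (-1) := by
    have := t.isGE_shift X₁ 1 (-1) 2
    exact t.isGE₂ _ (inv_rot_of_distTriang _ hT') (-1) (t.isGE_of_ge (X₁⟦(-1 : ℤ)⟧) (-1) 2) ⟨hX'⟩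
  have h₀ := hP.extensionProduct_of_isGE_of_isLE X₀ hX₀' ⟨hX₀⟩
  have h₁ := hP.tiltCoaisle_of_isGE_one X₁
  let Q := P.extensionProduct (P.map (shiftFunctor C (1 : ℤ)))
  have h₂ : (Q.extensionProduct (tiltCoaisle t P)) X' := by
    have : ((Q.extensionProduct (tiltCoaisle t P)).extensionProduct (tiltCoaisle t P)) X' :=
      ⟨X₀, X₁, f', g', h', hT', h₀, h₁⟩
    rw [ObjectProperty.extensionProduct_assoc] at this
    exact ObjectProperty.monotone_extensionProduct_right _
      (ObjectProperty.extensionProduct_le_of_isTriangulatedClosed₂ le_rfl le_rfl) _ this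
  rw [ObjectProperty.extensionProduct_assoc, ObjectProperty.extensionProduct_assoc,
    ← ObjectProperty.extensionProduct_assoc P]
  exact ⟨W, X', f, g, h, hT, hW, h₂⟩

omit [CategoryTheory.IsTriangulated C] in
lemma extensionProduct_le_tiltAisle :
    ((t.le (-2)).extensionProduct P).extensionProduct (P.map (shiftFunctor C (1 : ℤ))) ≤
      tiltAisle t P :=
  ObjectProperty.extensionProduct_le_of_isTriangulatedClosed₂
    (ObjectProperty.extensionProduct_le_of_isTriangulatedClosed₂ le_neg_two_le_tiltAisle
      le_tiltAisle) map_shift_le_tiltAisle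

lemma tiltAisle_eq (hP : IsTwoTilting t P) : tiltAisle t P =
    ((t.le (-2)).extensionProduct P).extensionProduct (P.map (shiftFunctor C (1 : ℤ))) := by
  refine le_antisymm (fun X hX ↦ ?_) extensionProduct_le_tiltAisle
  obtain ⟨U, V, f, g, h, hT, hU, hV⟩ := hP.extensionProduct_tiltCoaisle X
  have hg : g = 0 := hX g hV
  -- As `g = 0`, the identity of `V` factors through `V ⟶ U[1]`, and the aisle object `U[1]` has no
  -- nonzero map to `V`.
  have hV' : IsZero V := by
    rw [IsZero.iff_id_eq_zero]
    obtain ⟨φ, hφ⟩ := mk_yoneda₃ hT (𝟙 V) (by rw [hg, zero_comp])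
    rw [hφ, hP.tiltAisle_shift_one (extensionProduct_le_tiltAisle _ hU) φ hV, comp_zero]
  have : IsIso f := (Triangle.isZero₃_iff_isIso₁ _ hT).1 hV'
  exact ObjectProperty.prop_of_iso _ (asIso f) hU

/-- The t-structure with aisle `t.le (-2) ⋆ P ⋆ P[1]`. -/
def tilt (hP : IsTwoTilting t P) : TStructure C where
  le n X := tiltAisle t P (X⟦n⟧)
  -- `tiltCoaisle` is the `≥ 1` part, orthogonal to the aisle; hence the shift by `n - 1`.
  ge n X := tiltCoaisle t P (X⟦n - 1⟧)
  le_isClosedUnderIsomorphisms n :=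
    ⟨fun e h ↦ (tiltAisle t P).prop_of_iso ((shiftFunctor C n).mapIso e) h⟩
  ge_isClosedUnderIsomorphisms n :=
    ⟨fun e h ↦ (tiltCoaisle t P).prop_of_iso ((shiftFunctor C (n - 1)).mapIso e) h⟩
  le_shift n a n' h X hX :=
    (tiltAisle t P).prop_of_iso ((shiftFunctorAdd' C a n' n h).app X) hX
  ge_shift n a n' h X hX :=
    (tiltCoaisle t P).prop_of_iso ((shiftFunctorAdd' C a (n' - 1) (n - 1) (by lia)).app X) hX
  zero' X Y f hX hY := by
    rw [← cancel_epi ((shiftFunctorZero C ℤ).hom.app X),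
      ← cancel_mono ((shiftFunctorZero C ℤ).inv.app Y), comp_zero, zero_comp]
    exact hX _ hY
  le_zero_le X hX := (tiltAisle t P).prop_of_iso
    ((shiftFunctorAdd' C 0 1 1 (by simp)).symm.app X) (hP.tiltAisle_shift_one hX)
  ge_one_le X hX := (tiltCoaisle t P).prop_of_iso
    ((shiftFunctorAdd' C (1 - 1) (-1) (0 - 1) (by simp)).symm.app X)
      (hP.tiltCoaisle_shift_neg_one hX)
  exists_triangle_zero_one X := by
    obtain ⟨U, V, f, g, h, hT, hU, hV⟩ := hP.extensionProduct_tiltCoaisle X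
    refine ⟨U, V, ?_, ?_, f, g, h, hT⟩
    · exact (tiltAisle t P).prop_of_iso ((shiftFunctorZero C ℤ).symm.app U)
        (extensionProduct_le_tiltAisle _ hU)
    · exact (tiltCoaisle t P).prop_of_iso ((shiftFunctorZero C ℤ).symm.app V) hV

lemma tilt_le_iff (hP : IsTwoTilting t P) (X : C) : hP.tilt.le 0 X ↔ tiltAisle t P X :=
  (tiltAisle t P).prop_iff_of_iso ((shiftFunctorZero C ℤ).app X)

lemma tilt_ge_iff (hP : IsTwoTilting t P) (X : C) : hP.tilt.ge 1 X ↔ tiltCoaisle t P X :=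
  (tiltCoaisle t P).prop_iff_of_iso ((shiftFunctorZero C ℤ).app X)

lemma tilt_le_zero (hP : IsTwoTilting t P) : hP.tilt.le 0 =
    ((t.le (-2)).extensionProduct P).extensionProduct (P.map (shiftFunctor C (1 : ℤ))) := by
  rw [← hP.tiltAisle_eq]
  ext X
  exact hP.tilt_le_iff X

lemma tilt_le_zero_le (hP : IsTwoTilting t P) : hP.tilt.le 0 ≤ t.le 0 := by
  rw [tilt_le_zero]
  refine ObjectProperty.extensionProduct_le_of_isTriangulatedClosed₂
    (ObjectProperty.extensionProduct_le_of_isTriangulatedClosed₂ (t.le_monotone (by simp))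
      (fun X hX ↦ (hP.isLE hX).le)) ?_
  rintro X ⟨Y, hY, ⟨e⟩⟩
  have := hP.isLE hY
  have := t.isLE_shift Y 0 1 (-1)
  have := t.isLE_of_le (Y⟦(1 : ℤ)⟧) (-1) 0
  exact (t.isLE_of_iso e 0).le

lemma le_neg_two_le_tilt_le_zero (hP : IsTwoTilting t P) : t.le (-2) ≤ hP.tilt.le 0 :=
  fun X hX ↦ (hP.tilt_le_iff X).2 (le_neg_two_le_tiltAisle _ hX)

lemma eq_heartInter (hP : IsTwoTilting t P) : P = heartInter t hP.tilt := by
  have := hP.isClosedUnderIsomorphisms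
  ext X
  refine ⟨fun hX ↦ ⟨hP.le_heart _ hX, (hP.tilt_le_iff X).2 (le_tiltAisle _ hX), ?_⟩,
    fun hX ↦ ?_⟩
  · have := hP.isGE hX
    have := t.isGE_shift X 0 (-1) 1
    exact (hP.tilt.ge 0).prop_of_iso ((shiftFunctorCompIsoId C (-1 : ℤ) 1 (by simp)).app X)
      (hP.tilt.ge_shift 1 1 0 (by simp) _
        ((hP.tilt_ge_iff (X⟦(-1 : ℤ)⟧)).2 (hP.tiltCoaisle_of_isGE_one _)))
  -- Write `X` as an extension of `V`, in `P ⋆ P[1]`, by `U`, which is `≤ -2`. For degree reasons `U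
  -- ⟶ X` and `V ⟶ U[1]` vanish, so `U[1] = 0` and `X ≅ V`. Then `X` is the cone of a map `Z ⟶ K` of
  -- `P` and lies in the heart, so it is in `P`.
  · obtain ⟨_, _⟩ := (t.mem_heart_iff _).1 hX.1
    have hX' := hX.2.1
    rw [tilt_le_zero, ObjectProperty.extensionProduct_assoc] at hX'
    obtain ⟨U, V, f, g, h, hT, hU, K, Y, a, b, c, hT', hK, ⟨Z, hZ, ⟨e⟩⟩⟩ := hX'
    have : t.IsLE U (-2) := ⟨hU⟩
    have hf : f = 0 := t.zero f (-2) 0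
    have : t.IsGE V (-1) := by
      have := hP.isGE hK
      have := hP.isGE hZ
      have := t.isGE_shift Z 0 1 (-1)
      exact t.isGE₂ _ hT' (-1) (t.isGE_of_ge K (-1) 0) (t.isGE_of_iso e (-1))
    have hU' : IsZero (U⟦(1 : ℤ)⟧) := by
      have := t.isLE_shift U (-2) 1 (-3)
      rw [IsZero.iff_id_eq_zero]
      obtain ⟨φ, hφ⟩ := mk_coyoneda₃ (mk_rotate hT) (𝟙 (U⟦(1 : ℤ)⟧))
        (by rw [hf, Functor.map_zero, neg_zero, comp_zero])
      rw [hφ, show φ = 0 from t.zero φ (-3) (-1), zero_comp]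
    have : IsIso g := (Triangle.isZero₃_iff_isIso₁ _ (rot_of_distTriang _ hT)).1 hU'
    have hV : t.heart V := t.heart.prop_of_iso (asIso g) hX.1
    obtain ⟨z, hz⟩ := (shiftFunctor C (1 : ℤ)).map_surjective (e.hom ≫ c)
    refine P.prop_of_iso (asIso g).symm (hP.prop_of_distinguished
      (T := Triangle.mk (-z) a (b ≫ e.inv)) (mk_of_rotate ?_) hZ hK hV)
    exact mk_of_iso hT' (Iso.refl _) (Iso.refl _) e.symm (by simp) (by simp) (by simp [hz])

end IsTwoTilting

end CategoryTheory.Triangulated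

/-! ### Splitting off the top term of a bounded above complex -/

namespace CochainComplex

variable {A : Type u} [Category.{v} A] [Abelian A]

/-- A complex `K` which is strictly `≤ n` has the subcomplex given by its component in degree `n`;
the quotient has the other components. -/
lemma exists_shortExact_single (K : CochainComplex A ℤ) (n : ℤ) [K.IsStrictlyLE n] :
    ∃ (W : CochainComplex A ℤ) (f : (HomologicalComplex.single A (.up ℤ) n).obj (K.X n) ⟶ K)
      (g : K ⟶ W) (w : f ≫ g = 0), (ShortComplex.mk f g w).ShortExact ∧ W.IsStrictlyLE (n - 1) ∧
      ∀ i < n, Nonempty (K.X i ≅ W.X i) := by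
  let f : (HomologicalComplex.single A (.up ℤ) n).obj (K.X n) ⟶ K :=
    HomologicalComplex.mkHomFromSingle (𝟙 _)
      (fun k hk ↦ (K.isZero_of_isStrictlyLE n k (by simp at hk; lia)).eq_of_tgt _ _)
  have hf : IsIso (f.f n) := by
    rw [HomologicalComplex.mkHomFromSingle_f, Category.comp_id]
    infer_instance
  have hz (i : ℤ) (hi : i ≠ n) :
      IsZero (((HomologicalComplex.single A (.up ℤ) n).obj (K.X n)).X i) :=
    HomologicalComplex.isZero_single_obj_X _ _ _ _ hi
  have : Mono f := by
    have (i : ℤ) : Mono (f.f i) := by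
      by_cases hi : i = n
      · subst hi; infer_instance
      · exact ⟨fun _ _ _ ↦ (hz i hi).eq_of_tgt _ _⟩
    exact HomologicalComplex.mono_of_mono_f f this
  have hS : (ShortComplex.mk f (cokernel.π f) (cokernel.condition f)).ShortExact :=
    { exact := ShortComplex.exact_cokernel f }
  have hS' (i : ℤ) := hS.map_of_exact (HomologicalComplex.eval A (.up ℤ) i)
  refine ⟨cokernel f, f, cokernel.π f, cokernel.condition f, hS, ?_, fun i hi ↦ ?_⟩
  · rw [isStrictlyLE_iff]
    intro i hi
    by_cases hi' : i = n
    · subst hi'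
      exact (hS' i).isIso_f_iff.1 hf
    · have : IsIso ((cokernel.π f).f i) := (hS' i).isIso_g_iff.2 (hz i hi')
      exact (K.isZero_of_isStrictlyLE n i (by lia)).of_iso (asIso ((cokernel.π f).f i)).symm
  · have : IsIso ((cokernel.π f).f i) := (hS' i).isIso_g_iff.2 (hz i (by lia))
    exact ⟨asIso ((cokernel.π f).f i)⟩

end CochainComplex

namespace DerivedCategory

variable {A : Type u} [Category.{v} A] [Abelian A] [HasDerivedCategory.{w} A]

lemma exists_distinguished_single (K : CochainComplex A ℤ) (n : ℤ) [K.IsStrictlyLE n] :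
    ∃ (W : CochainComplex A ℤ) (f : (singleFunctor A n).obj (K.X n) ⟶ Q.obj K)
      (g : Q.obj K ⟶ Q.obj W) (h : Q.obj W ⟶ ((singleFunctor A n).obj (K.X n))⟦(1 : ℤ)⟧),
      Triangle.mk f g h ∈ distTriang (DerivedCategory A) ∧ W.IsStrictlyLE (n - 1) ∧
      ∀ i < n, Nonempty (K.X i ≅ W.X i) := by
  obtain ⟨W, f, g, w, hS, h₁, h₂⟩ := K.exists_shortExact_single n
  exact ⟨W, Q.map f, Q.map g, triangleOfSESδ hS, triangleOfSES_distinguished hS, h₁, h₂⟩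

/-- The isomorphism between the object of the derived category in degree `n` and the shift of
the object in degree `n + a`. -/
lemma nonempty_singleFunctor_iso_shift (X : A) (a n m : ℤ) (h : a + n = m) :
    Nonempty ((singleFunctor A n).obj X ≅ ((singleFunctor A m).obj X)⟦a⟧) :=
  ⟨((singleFunctors A).shiftIso a n m h).symm.app X⟩

end DerivedCategory

/-! ### Short exact sequences versus distinguished triangles -/

namespace CategoryTheory

section

variable {A : Type*} [Category* A] [Abelian A] {C : Type*} [Category* C] [Preadditive C]
  [HasZeroObject C] [HasShift C ℤ] [∀ n : ℤ, (shiftFunctor C n).Additive] [Pretriangulated C]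
  {ι : A ⥤ C} [ι.Additive] [ι.Full] [ι.Faithful]

lemma shortExact_of_distinguished
    (hι : ∀ ⦃X Y : A⦄ ⦃n : ℤ⦄ (f : ι.obj X ⟶ (ι.obj Y)⟦n⟧), n < 0 → f = 0)
    {X₁ X₂ X₃ : A} {f : X₁ ⟶ X₂} {g : X₂ ⟶ X₃} {δ : ι.obj X₃ ⟶ (ι.obj X₁)⟦(1 : ℤ)⟧}
    (hT : Triangle.mk (ι.map f) (ι.map g) δ ∈ distTriang C) :
    ∃ w : f ≫ g = 0, (ShortComplex.mk f g w).ShortExact := by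
  have w : f ≫ g = 0 := ι.map_injective (by
    rw [Functor.map_comp, mk_zero₁₂ hT, Functor.map_zero])
  have h₁ := AbelianSubcategory.isLimitKernelForkOfDistTriang hι f g δ hT
  have h₂ := AbelianSubcategory.isColimitCokernelCoforkOfDistTriang hι f g δ hT
  have : Mono f := mono_of_isLimit_fork h₁
  have : Epi g := epi_of_isColimit_cofork h₂
  exact ⟨w, { exact := ShortComplex.exact_of_f_is_kernel _ h₁ }⟩

/-- Variant of `shortExact_of_distinguished` for triangles up to isomorphism. -/
lemma exists_shortExact_of_distinguished
    (hι : ∀ ⦃X Y : A⦄ ⦃n : ℤ⦄ (f : ι.obj X ⟶ (ι.obj Y)⟦n⟧), n < 0 → f = 0)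
    {T : Triangle C} (hT : T ∈ distTriang C) {X₁ X₂ X₃ : A} (e₁ : ι.obj X₁ ≅ T.obj₁)
    (e₂ : ι.obj X₂ ≅ T.obj₂) (e₃ : ι.obj X₃ ≅ T.obj₃) :
    ∃ (f : X₁ ⟶ X₂) (g : X₂ ⟶ X₃) (w : f ≫ g = 0), (ShortComplex.mk f g w).ShortExact := by
  obtain ⟨f, hf⟩ := ι.map_surjective (e₁.hom ≫ T.mor₁ ≫ e₂.inv)
  obtain ⟨g, hg⟩ := ι.map_surjective (e₂.hom ≫ T.mor₂ ≫ e₃.inv)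
  have hT' : Triangle.mk (ι.map f) (ι.map g) (e₃.hom ≫ T.mor₃ ≫ e₁.inv⟦(1 : ℤ)⟧') ∈
      distTriang C := by
    refine mk_of_iso (f := T.mor₁) (g := T.mor₂) (h := T.mor₃) hT e₁.symm e₂.symm e₃.symm ?_ ?_ ?_
    · simp [hf]
    · simp [hg]
    · simp
  obtain ⟨w, hw⟩ := shortExact_of_distinguished hι hT'
  exact ⟨f, g, w, hw⟩

/-- An epimorphism `S.g` extends to a triangle with first vertex in `A`; that vertex is a kernel of
`S.g`, hence isomorphic to `S.X₁` compatibly with `S.f`. -/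
lemma exists_distinguished_of_shortExact
    (hι : ∀ ⦃X Y : A⦄ ⦃n : ℤ⦄ (f : ι.obj X ⟶ (ι.obj Y)⟦n⟧), n < 0 → f = 0)
    (h : AbelianSubcategory.admissibleMorphism ι = ⊤)
    {S : ShortComplex A} (hS : S.ShortExact) :
    ∃ δ : ι.obj S.X₃ ⟶ (ι.obj S.X₁)⟦(1 : ℤ)⟧,
      Triangle.mk (ι.map S.f) (ι.map S.g) δ ∈ distTriang C := by
  have := hS.epi_g
  obtain ⟨X, i, δ, hT⟩ := AbelianSubcategory.exists_distinguished_triangle_of_epi hι h S.g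
  have h₁ := AbelianSubcategory.isLimitKernelForkOfDistTriang hι i S.g δ hT
  let e : X ≅ S.X₁ := h₁.conePointUniqueUpToIso hS.fIsKernel
  have he : e.hom ≫ S.f = i :=
    IsLimit.conePointUniqueUpToIso_hom_comp h₁ hS.fIsKernel WalkingParallelPair.zero
  refine ⟨δ ≫ (ι.map e.hom)⟦(1 : ℤ)⟧', mk_of_iso hT (ι.mapIso e) (Iso.refl _) (Iso.refl _) ?_ ?_ ?_⟩
  · rw [Iso.refl_hom, Category.comp_id, ← he, Functor.map_comp]; rfl
  · simp
  · simp

end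

section

variable {C : Type*} [Category* C] [Preadditive C] [HasZeroObject C] [HasShift C ℤ]
  [∀ n : ℤ, (shiftFunctor C n).Additive] [Pretriangulated C] (t : TStructure C)

lemma heart_hom_eq_zero ⦃X Y : t.heart.FullSubcategory⦄ ⦃n : ℤ⦄
    (f : t.heart.ι.obj X ⟶ (t.heart.ι.obj Y)⟦n⟧) (hn : n < 0) : f = 0 := by
  have hX : t.IsLE X.obj 0 := ((t.mem_heart_iff _).1 X.2).1
  have hY : t.IsGE Y.obj 0 := ((t.mem_heart_iff _).1 Y.2).2
  have hY' : t.IsGE (Y.obj⟦n⟧) (-n) := t.isGE_shift Y.obj 0 n (-n)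
  exact t.zero_of_isLE_of_isGE f 0 (-n) (by lia) hX hY'

/-- The cone of a map of the heart lives in degrees -1 and 0; its two truncations are the shifted
kernel and the cokernel. -/
lemma heart_admissibleMorphism [CategoryTheory.IsTriangulated C] :
    AbelianSubcategory.admissibleMorphism t.heart.ι = ⊤ := by
  refine top_unique ?_
  rintro X₁ X₂ f₁ - X₃ f₂ f₃ hT
  have h₁ := (t.mem_heart_iff _).1 X₁.2
  have h₂ := (t.mem_heart_iff _).1 X₂.2
  have : t.IsLE X₁.obj 0 := h₁.1
  have : t.IsGE X₁.obj 0 := h₁.2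
  have : t.IsGE X₂.obj 0 := h₂.2
  have hT' := rot_of_distTriang _ hT
  have hL : t.IsLE (X₁.obj⟦(1 : ℤ)⟧) (-1) := t.isLE_shift X₁.obj 0 1 (-1)
  have hG : t.IsGE (X₁.obj⟦(1 : ℤ)⟧) (-1) := t.isGE_shift X₁.obj 0 1 (-1)
  have : t.IsLE X₃ 0 := t.isLE₂ _ hT' 0 h₂.1 (t.isLE_of_le (X₁.obj⟦(1 : ℤ)⟧) (-1) 0)
  have : t.IsGE X₃ (-1) := t.isGE₂ _ hT' (-1) (t.isGE_of_ge X₂.obj (-1) 0) hG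
  obtain ⟨U, V, hU, hV, a, b, c, habc⟩ := t.exists_triangle X₃ (-1) 0 (by simp)
  have : t.IsLE U (-1) := ⟨hU⟩
  have : t.IsGE V 0 := ⟨hV⟩
  have : t.IsGE U (-1) := t.isGE₂ _ (inv_rot_of_distTriang _ habc) (-1)
    (by
      have := t.isGE_shift V 0 (-1) 1
      exact t.isGE_of_ge (V⟦(-1 : ℤ)⟧) (-1) 1) ‹_›
  have : t.IsLE V 0 := t.isLE₂ _ (rot_of_distTriang _ habc) 0 ‹_› (by
      have := t.isLE_shift U (-1) 1 (-2)
      exact t.isLE_of_le (U⟦(1 : ℤ)⟧) (-2) 0)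
  let e : (U⟦(-1 : ℤ)⟧)⟦(1 : ℤ)⟧ ≅ U := (shiftFunctorCompIsoId C (-1 : ℤ) 1 (by simp)).app _
  have hK : t.heart (U⟦(-1 : ℤ)⟧) := (t.mem_heart_iff _).2
    ⟨t.isLE_shift _ (-1) (-1) 0, t.isGE_shift _ (-1) (-1) 0⟩
  have hQ : t.heart V := (t.mem_heart_iff _).2 ⟨inferInstance, inferInstance⟩
  exact ⟨⟨_, hK⟩, ⟨_, hQ⟩, e.hom ≫ a, b, c ≫ e.inv⟦(1 : ℤ)⟧',
    mk_of_iso habc e.symm (Iso.refl _) (Iso.refl _) (by simp) (by simp) (by simp)⟩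

end

lemma singleFunctor_hom_eq_zero {A : Type u} [Category.{v} A] [Abelian A] [HasDerivedCategory.{w} A]
    ⦃X Y : A⦄ ⦃n : ℤ⦄ (f : (DerivedCategory.singleFunctor A 0).obj X ⟶
      ((DerivedCategory.singleFunctor A 0).obj Y)⟦n⟧) (hn : n < 0) : f = 0 := by
  have := DerivedCategory.TStructure.t.isGE_shift
    ((DerivedCategory.singleFunctor A 0).obj Y) 0 n (-n)
  exact DerivedCategory.TStructure.t.zero f 0 (-n) (by lia)

end CategoryTheory

/-! ### 2-tilting torsion classes inside the abelian category -/

namespace IsTwoTiltingTorsionClass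

variable {A : Type u} [Category.{v} A] [Abelian A] {E : ObjectProperty A}

lemma isClosedUnderIsomorphisms (hE : IsTwoTiltingTorsionClass E) :
    E.IsClosedUnderIsomorphisms where
  -- The last condition is applied to `0 ⟶ X ⟶ X ⟶ X ⟶ Y ⟶ 0` with maps `𝟙 X`, `0`, `e`.
  of_iso {X Y} e hX := hE.prop_of_exact (𝟙 X) (0 : X ⟶ X) e.hom (by simp) (by simp)
    inferInstance (by rw [ShortComplex.exact_iff_epi _ rfl]; dsimp; infer_instance)
    (by rw [ShortComplex.exact_iff_mono _ rfl]; dsimp; infer_instance) inferInstance hX hX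

lemma prop_of_exact_of_epi (hE : IsTwoTiltingTorsionClass E) {S : ShortComplex A}
    (hS : S.Exact) (hg : Epi S.g) (h₁ : E S.X₁) (h₂ : E S.X₂) : E S.X₃ :=
  hE.prop_of_exact (kernel.ι S.f) S.f S.g (by simp) S.zero inferInstance
    (ShortComplex.exact_kernel _) hS hg h₁ h₂

lemma prop_zero (hE : IsTwoTiltingTorsionClass E) {X : A} (hX : IsZero X) : E X := by
  obtain ⟨Y, f, hY, hf⟩ := hE.cogenerates X
  exact hE.prop_of_exact_of_epi (S := ShortComplex.mk (𝟙 Y) (0 : Y ⟶ X) (by simp))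
    (by rw [ShortComplex.exact_iff_epi _ rfl]; dsimp; infer_instance)
    ⟨fun _ _ _ ↦ hX.eq_of_src _ _⟩ hY hY

lemma containsZero (hE : IsTwoTiltingTorsionClass E) : E.ContainsZero where
  exists_zero := by
    obtain ⟨Z, hZ⟩ := HasZeroObject.zero (C := A)
    exact ⟨Z, hZ, hE.prop_zero hZ⟩

lemma isClosedUnderFiniteProducts (hE : IsTwoTiltingTorsionClass E) :
    E.IsClosedUnderFiniteProducts := by
  have := hE.containsZero
  have := hE.isClosedUnderIsomorphisms
  have := hE.isClosedUnderExtensions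
  have : E.IsClosedUnderBinaryProducts := ⟨by
    rintro Z ⟨p⟩
    have e : Z ≅ p.diag.obj ⟨.left⟩ ⊞ p.diag.obj ⟨.right⟩ :=
      p.isLimit.conePointUniqueUpToIso
        ((IsLimit.postcomposeHomEquiv (diagramIsoPair p.diag).symm _).symm
          (BinaryBiproduct.isLimit (p.diag.obj ⟨.left⟩) (p.diag.obj ⟨.right⟩)))
    exact E.prop_of_iso e.symm (E.prop_biprod (p.prop_diag_obj _) (p.prop_diag_obj _))⟩
  exact .mk'

lemma isCoresolving (hE : IsTwoTiltingTorsionClass E) : IsCoresolving E.ι where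
  exists_mono X := by
    obtain ⟨Y, f, hY, hf⟩ := hE.cogenerates X
    exact ⟨⟨Y, hY⟩, f, hf⟩
  exists_cokernel {X Y} f := by
    have h := hE.prop_of_exact_of_epi (ShortComplex.exact_cokernel f.hom)
      (inferInstanceAs (Epi (cokernel.π f.hom))) X.2 Y.2
    exact ⟨⟨cokernel f.hom, h⟩, ObjectProperty.homMk (cokernel.π f.hom), cokernel.condition f.hom,
      ShortComplex.exact_cokernel f.hom, inferInstanceAs (Epi (cokernel.π f.hom))⟩

/-- Any object of `A` has a coreflection in a 2-tilting torsion class. -/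
lemma exists_coreflection (hE : IsTwoTiltingTorsionClass E) (Z : A) :
    ∃ (K : A) (c : K ⟶ Z), E K ∧ ∀ X, E X → Function.Bijective (fun f : X ⟶ K ↦ f ≫ c) := by
  have := hE.hasKernels
  have := hE.containsZero
  -- `Z` is the kernel in `A` of `d : Y₀ ⟶ Y₁`. For `X` in `E`, maps from `X` to `Z` and to the
  -- kernel of `d` in `E` are both the maps `X ⟶ Y₀` killed by `d`.
  obtain ⟨Y₀, f₀, h₀, _⟩ := hE.cogenerates Z
  obtain ⟨Y₁, f₁, h₁, _⟩ := hE.cogenerates (cokernel f₀)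
  let d : (⟨Y₀, h₀⟩ : E.FullSubcategory) ⟶ ⟨Y₁, h₁⟩ :=
    ObjectProperty.homMk (cokernel.π f₀ ≫ f₁)
  have hd {X : A} (x : X ⟶ Y₀) (hx : x ≫ cokernel.π f₀ ≫ f₁ = 0) : ∃ y : X ⟶ Z, y ≫ f₀ = x := by
    have h : x ≫ cokernel.π f₀ = 0 := by rw [← cancel_mono f₁, Category.assoc, hx, zero_comp]
    exact ⟨(ShortComplex.exact_cokernel f₀).lift x h, (ShortComplex.exact_cokernel f₀).lift_f x h⟩
  have hι : (kernel.ι d).hom ≫ cokernel.π f₀ ≫ f₁ = 0 :=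
    congrArg InducedCategory.Hom.hom (kernel.condition d)
  obtain ⟨c, hc⟩ := hd _ hι
  refine ⟨(kernel d).obj, c, (kernel d).property, fun X hX ↦ ⟨fun f g hfg ↦ ?_, fun g ↦ ?_⟩⟩
  · have h : ObjectProperty.homMk (X := ⟨X, hX⟩) f ≫ kernel.ι d =
        ObjectProperty.homMk (X := ⟨X, hX⟩) g ≫ kernel.ι d := by
      ext
      change f ≫ (kernel.ι d).hom = g ≫ (kernel.ι d).hom
      rw [← hc, ← Category.assoc, ← Category.assoc]
      exact congrArg (· ≫ f₀) hfg
    exact congrArg InducedCategory.Hom.hom ((cancel_mono _).1 h)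
  · let g' : (⟨X, hX⟩ : E.FullSubcategory) ⟶ ⟨Y₀, h₀⟩ := ObjectProperty.homMk (g ≫ f₀)
    have hg' : g' ≫ d = 0 := by
      ext
      change (g ≫ f₀) ≫ cokernel.π f₀ ≫ f₁ = 0
      simp
    refine ⟨(kernel.lift d g' hg').hom, ?_⟩
    have h : (kernel.lift d g' hg').hom ≫ (kernel.ι d).hom = g ≫ f₀ :=
      congrArg InducedCategory.Hom.hom (kernel.lift_ι d g' hg')
    rw [← cancel_mono f₀]
    exact (Category.assoc _ _ _).trans ((congrArg _ hc).trans h)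

end IsTwoTiltingTorsionClass

/-! ### The torsion class as a subcategory of the derived category -/

section

open DerivedCategory

variable {A : Type u} [Category.{v} A] [Abelian A] [HasDerivedCategory.{w} A]
  {E : ObjectProperty A}

lemma inDerived_iff (X : DerivedCategory A) :
    inDerived E X ↔ ∃ Y, E Y ∧ Nonempty ((singleFunctor A 0).obj Y ≅ X) :=
  Iff.rfl

lemma inDerived_singleFunctor_obj {Y : A} (hY : E Y) : inDerived E ((singleFunctor A 0).obj Y) :=
  ⟨Y, hY, ⟨Iso.refl _⟩⟩

lemma inDerived_le_heart : inDerived E ≤ TStructure.t.heart := by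
  rintro X ⟨Y, hY, ⟨e⟩⟩
  exact (TStructure.t.mem_heart_iff _).2 ⟨TStructure.t.isLE_of_iso e 0, TStructure.t.isGE_of_iso e 0⟩

lemma exists_singleFunctor_iso_of_heart {X : DerivedCategory A} (hX : TStructure.t.heart X) :
    ∃ Y : A, Nonempty ((singleFunctor A 0).obj Y ≅ X) := by
  obtain ⟨_, _⟩ := (TStructure.t.mem_heart_iff _).1 hX
  obtain ⟨Y, ⟨e⟩⟩ := X.exists_iso_singleFunctor_obj_of_isGE_of_isLE 0
  exact ⟨Y, ⟨e.symm⟩⟩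

lemma singleFunctor_obj_mem_heart (X : A) :
    (TStructure.t : TStructure (DerivedCategory A)).heart ((singleFunctor A 0).obj X) :=
  (TStructure.t.mem_heart_iff _).2 ⟨inferInstance, inferInstance⟩

namespace IsTwoTiltingTorsionClass

lemma exists_complex (hE : IsTwoTiltingTorsionClass E) (X : DerivedCategory A) :
    ∃ K : CochainComplex A ℤ, (∀ i, E (K.X i)) ∧ Nonempty (X ≅ Q.obj K) := by
  have := hE.containsZero
  have := hE.isClosedUnderFiniteProducts
  have : HasBinaryBiproducts E.FullSubcategory := HasBinaryBiproducts.of_hasBinaryProducts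
  obtain ⟨Y, ⟨e⟩⟩ := hE.isCoresolving.exists_iso_Q_obj X
  exact ⟨_, fun i ↦ (Y.X i).property, ⟨e⟩⟩

/-- Represent `X` by a complex over `E` and truncate it to degrees -1 and 0. The stupid filtration
of the two-term complex is the triangle; only its degree 0 term may leave `E`. -/
lemma exists_triangle (hE : IsTwoTiltingTorsionClass E) (X : DerivedCategory A)
    [X.IsGE (-1)] [X.IsLE 0] :
    ∃ (Z Y : DerivedCategory A) (f : Z ⟶ X) (g : X ⟶ Y⟦(1 : ℤ)⟧) (h : Y⟦(1 : ℤ)⟧ ⟶ Z⟦(1 : ℤ)⟧),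
      Triangle.mk f g h ∈ distTriang (DerivedCategory A) ∧ TStructure.t.heart Z ∧
        inDerived E Y := by
  have := hE.isClosedUnderIsomorphisms
  obtain ⟨L, hL, ⟨e⟩⟩ := hE.exists_complex X
  have : L.IsGE (-1) := by rw [← isGE_Q_obj_iff]; exact TStructure.t.isGE_of_iso e (-1)
  let e₁ : X ≅ Q.obj (L.truncGE (-1)) := e ≪≫ asIso (Q.map (L.πTruncGE (-1)))
  have : (L.truncGE (-1)).IsLE 0 := by
    rw [← isLE_Q_obj_iff]; exact TStructure.t.isLE_of_iso e₁ 0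
  let K := (L.truncGE (-1)).truncLE 0
  let e₂ : X ≅ Q.obj K := e₁ ≪≫ (asIso (Q.map ((L.truncGE (-1)).ιTruncLE 0))).symm
  -- The lower truncation puts in degree -1 the cokernel of `L.X (-2) ⟶ L.X (-1)`, which is in `E`.
  have h₁ : E (K.X (-1)) := by
    refine E.prop_of_iso ((L.truncGE (-1)).truncLEXIso 0 (-1) ≪≫ L.truncGEXIsoOpcycles (-1)).symm ?_
    exact hE.prop_of_exact_of_epi (S := ShortComplex.mk _ _ (L.d_pOpcycles (-2) (-1)))
      (ShortComplex.exact_of_g_is_cokernel _ (L.opcyclesIsCokernel (-2) (-1) (by simp)))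
      (inferInstanceAs (Epi (L.pOpcycles (-1)))) (hL _) (hL _)
  have h₂ (i : ℤ) (hi : i < -1) : IsZero (K.X i) :=
    ((L.truncGE (-1)).isZero_of_isStrictlyGE (-1) i hi).of_iso ((L.truncGE (-1)).truncLEXIso 0 i)
  obtain ⟨W, f, g, h, hT, _, hW⟩ := exists_distinguished_single K 0
  have : W.IsStrictlyLE (-1) := ‹_›
  have : W.IsStrictlyGE (-1) := by
    rw [CochainComplex.isStrictlyGE_iff]
    exact fun i hi ↦ (h₂ i hi).of_iso (hW i (by lia)).some.symm
  obtain ⟨N, ⟨φ⟩⟩ := W.exists_iso_single (-1)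
  have φ' : W.X (-1) ≅ ((HomologicalComplex.single A (.up ℤ) (-1)).obj N).X (-1) :=
    (HomologicalComplex.eval A (.up ℤ) (-1)).mapIso φ
  have hN : E N := E.prop_of_iso (((hW (-1) (by simp)).some ≪≫ φ') ≪≫
    HomologicalComplex.singleObjXSelf (.up ℤ) (-1) N) h₁
  obtain ⟨ψ⟩ := nonempty_singleFunctor_iso_shift N 1 (-1) 0 (by simp)
  let e₃ : Q.obj W ≅ ((singleFunctor A 0).obj N)⟦(1 : ℤ)⟧ := Q.mapIso φ ≪≫ ψ
  exact ⟨_, _, f ≫ e₂.inv, e₂.hom ≫ g ≫ e₃.hom, e₃.inv ≫ h,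
    mk_of_iso hT (Iso.refl _) e₂.symm e₃ (by simp) (by simp) (by simp),
    singleFunctor_obj_mem_heart _, inDerived_singleFunctor_obj hN⟩

lemma isTwoTilting (hE : IsTwoTiltingTorsionClass E) :
    IsTwoTilting TStructure.t (inDerived E) where
  isClosedUnderIsomorphisms := by unfold inDerived; infer_instance
  le_heart := inDerived_le_heart
  isTriangulatedClosed₂ := by
    have : (inDerived E).IsClosedUnderIsomorphisms := by unfold inDerived; infer_instance
    have := hE.isClosedUnderExtensions
    refine .mk' fun T hT h₁ h₃ ↦ ?_
    obtain ⟨X₁, hX₁, ⟨e₁⟩⟩ := (inDerived_iff _).1 h₁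
    obtain ⟨X₃, hX₃, ⟨e₃⟩⟩ := (inDerived_iff _).1 h₃
    obtain ⟨_, _⟩ := (TStructure.t.mem_heart_iff _).1 (inDerived_le_heart _ h₁)
    obtain ⟨_, _⟩ := (TStructure.t.mem_heart_iff _).1 (inDerived_le_heart _ h₃)
    obtain ⟨X₂, ⟨e₂⟩⟩ := exists_singleFunctor_iso_of_heart ((TStructure.t.mem_heart_iff T.obj₂).2
      ⟨TStructure.t.isLE₂ T hT 0 ‹_› ‹_›, TStructure.t.isGE₂ T hT 0 ‹_› ‹_›⟩)
    obtain ⟨f, g, w, hS⟩ :=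
      exists_shortExact_of_distinguished singleFunctor_hom_eq_zero hT e₁ e₂ e₃
    exact ⟨X₂, E.prop_X₂_of_shortExact hS hX₁ hX₃, ⟨e₂⟩⟩
  exists_coreflection Z hZ := by
    obtain ⟨Z', ⟨e⟩⟩ := exists_singleFunctor_iso_of_heart hZ
    obtain ⟨K, c, hK, hc⟩ := hE.exists_coreflection Z'
    refine ⟨_, (singleFunctor A 0).map c ≫ e.hom, inDerived_singleFunctor_obj hK, fun X hX ↦ ?_⟩
    obtain ⟨X', hX', ⟨e'⟩⟩ := (inDerived_iff _).1 hX
    refine ⟨fun f g hfg ↦ ?_, fun g ↦ ?_⟩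
    · obtain ⟨f', hf'⟩ := (singleFunctor A 0).map_surjective (e'.hom ≫ f)
      obtain ⟨g', hg'⟩ := (singleFunctor A 0).map_surjective (e'.hom ≫ g)
      have h : f' = g' := (hc X' hX').1 ((singleFunctor A 0).map_injective (by
        dsimp only at hfg ⊢
        rw [← cancel_mono e.hom, Functor.map_comp, Functor.map_comp, hf', hg']
        simpa using hfg))
      rw [← cancel_epi e'.hom, ← hf', ← hg', h]
    · obtain ⟨g', hg'⟩ := (singleFunctor A 0).map_surjective (e'.hom ≫ g ≫ e.inv)
      obtain ⟨k, hk⟩ := (hc X' hX').2 g'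
      refine ⟨e'.inv ≫ (singleFunctor A 0).map k, ?_⟩
      dsimp only at hk ⊢
      rw [Category.assoc, ← Functor.map_comp_assoc, hk, hg']
      simp
  exists_triangle X _ _ := hE.exists_triangle X
  prop_of_distinguished {T} hT h₁ h₂ h₃ := by
    obtain ⟨X₁, hX₁, ⟨e₁⟩⟩ := (inDerived_iff _).1 h₁
    obtain ⟨X₂, hX₂, ⟨e₂⟩⟩ := (inDerived_iff _).1 h₂
    obtain ⟨X₃, ⟨e₃⟩⟩ := exists_singleFunctor_iso_of_heart h₃
    obtain ⟨f, g, w, hS⟩ :=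
      exists_shortExact_of_distinguished singleFunctor_hom_eq_zero hT e₁ e₂ e₃
    exact ⟨X₃, hE.prop_of_exact_of_epi hS.exact hS.epi_g hX₁ hX₂, ⟨e₃⟩⟩

end IsTwoTiltingTorsionClass

end

/-! ### Generators and kernels in the tilted heart -/

namespace CategoryTheory.Triangulated

section

variable {C : Type u} [Category.{v} C] [Preadditive C] [HasZeroObject C] [HasShift C ℤ]
  [∀ n : ℤ, (shiftFunctor C n).Additive] [Pretriangulated C] [CategoryTheory.IsTriangulated C]

omit [CategoryTheory.IsTriangulated C] in
-- A map from `X` killed by `f` factors through `W`, which is `≤ -1`, so it vanishes if its target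
-- is in the heart.
lemma heart_epi_of_distinguished (t : TStructure C) {Z X : t.heart.FullSubcategory} (f : Z ⟶ X)
    {W : C} {g : X.obj ⟶ W} {h : W ⟶ Z.obj⟦(1 : ℤ)⟧}
    (hT : Triangle.mk f.hom g h ∈ distTriang C) (hW : t.IsLE W (-1)) : Epi f := by
  rw [Preadditive.epi_iff_cancel_zero]
  intro Y y hy
  obtain ⟨y', hy'⟩ := mk_yoneda₂ hT y.hom (congrArg InducedCategory.Hom.hom hy)
  have : t.IsGE Y.obj 0 := ((t.mem_heart_iff _).1 Y.2).2
  ext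
  exact hy'.trans ((congrArg _ (t.zero y' (-1) 0)).trans comp_zero)

namespace IsTwoTilting

variable {t : TStructure C} {P : ObjectProperty C}

omit [CategoryTheory.IsTriangulated C] in
/-- In a triangle `Z ⟶ X ⟶ W` with `Z` in the heart, `X` and `W[-1]` in the aisle, `Z` is in `P`. -/
lemma prop_of_tiltAisle (hP : IsTwoTilting t P) {Z X W : C} {f : Z ⟶ X} {g : X ⟶ W}
    {h : W ⟶ Z⟦(1 : ℤ)⟧} (hT : Triangle.mk f g h ∈ distTriang C) (hZ : t.heart Z)
    (hX : tiltAisle t P X) (hW : tiltAisle t P (W⟦(-1 : ℤ)⟧)) : P Z := by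
  have := hP.isClosedUnderIsomorphisms
  obtain ⟨K, c, hK, hc⟩ := hP.exists_coreflection Z hZ
  obtain ⟨V, d, δ, hV⟩ := distinguished_cocone_triangle c
  have hV' := hP.tiltCoaisle_of_distinguished hV hK hZ hc
  -- `d : Z ⟶ V` has target in the coaisle, so it vanishes on `W[-1]` and factors through `X`, from
  -- which every map to `V` is zero. Then `c` has a section, and a coreflection with a section is an
  -- isomorphism.
  have hd : d = 0 := by
    obtain ⟨y, hy⟩ := Triangle.yoneda_exact₂ _ (inv_rot_of_distTriang _ hT) d (hW _ hV')
    rw [hy, show y = 0 from hX y hV']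
    exact comp_zero
  obtain ⟨s, hs⟩ := mk_coyoneda₂ hV (𝟙 Z) (by rw [hd, comp_zero])
  have hs' : c ≫ s = 𝟙 K := (hc K hK).1 (by
    dsimp
    rw [Category.assoc, ← hs, Category.comp_id, Category.id_comp])
  exact P.prop_of_iso ⟨c, s, hs', hs.symm⟩ hK

/-- In the triangle given by `h`, `Z` is in `P` by `prop_of_tiltAisle`, and `W[-1]` in the aisle
means that `W` is `≤ -1` for the tilted t-structure, so `Z ⟶ X` is epi. -/
lemma exists_epi (hP : IsTwoTilting t P)
    (h : ∀ X, t.IsLE X 0 → ∃ (Z W : C) (f : Z ⟶ X) (g : X ⟶ W) (δ : W ⟶ Z⟦(1 : ℤ)⟧),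
      Triangle.mk f g δ ∈ distTriang C ∧ t.heart Z ∧ tiltAisle t P (W⟦(-1 : ℤ)⟧))
    (X : hP.tilt.heart.FullSubcategory) :
    ∃ (Y : (heartInter t hP.tilt).FullSubcategory)
      (f : (heartInterToRight t hP.tilt).obj Y ⟶ X), Epi f := by
  obtain ⟨Z, W, f, g, δ, hT, hZ, hW⟩ := h X.obj ⟨hP.tilt_le_zero_le _ X.property.1⟩
  have hZ' : heartInter t hP.tilt Z := by
    rw [← hP.eq_heartInter]
    exact hP.prop_of_tiltAisle hT hZ ((hP.tilt_le_iff _).1 X.property.1) hW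
  exact ⟨⟨Z, hZ'⟩, ObjectProperty.homMk f, heart_epi_of_distinguished _ _ hT ⟨hW⟩⟩

/-- The category `P` has kernels. -/
lemma exists_kernel (hP : IsTwoTilting t P) {X Y : C} (hX : P X) (hY : P Y) (f : X ⟶ Y) :
    ∃ (K : C) (k : K ⟶ X), P K ∧ k ≫ f = 0 ∧ ∀ (W : C), P W →
      (∀ (x : W ⟶ X), x ≫ f = 0 → ∃ y : W ⟶ K, y ≫ k = x) ∧
        ∀ (x : W ⟶ K), x ≫ k = 0 → x = 0 := by
  let f' : (⟨X, hP.le_heart _ hX⟩ : t.heart.FullSubcategory) ⟶ ⟨Y, hP.le_heart _ hY⟩ :=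
    ObjectProperty.homMk f
  obtain ⟨K, c, hK, hc⟩ := hP.exists_coreflection _ (kernel f').property
  refine ⟨K, c ≫ (kernel.ι f').hom, hK, ?_, fun W hW ↦ ⟨fun x hx ↦ ?_, fun x hx ↦ ?_⟩⟩
  · rw [Category.assoc]
    exact (congrArg _ (congrArg InducedCategory.Hom.hom (kernel.condition f'))).trans comp_zero
  · let x' : (⟨W, hP.le_heart _ hW⟩ : t.heart.FullSubcategory) ⟶ ⟨X, hP.le_heart _ hX⟩ :=
      ObjectProperty.homMk x
    have hx' : x' ≫ f' = 0 := by
      ext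
      exact hx
    obtain ⟨y, hy⟩ := (hc W hW).2 (kernel.lift f' x' hx').hom
    refine ⟨y, ?_⟩
    dsimp only at hy
    rw [← Category.assoc, hy]
    exact congrArg InducedCategory.Hom.hom (kernel.lift_ι f' x' hx')
  · have h₁ : ObjectProperty.homMk (x ≫ c) ≫ kernel.ι f' =
        (0 : (⟨W, hP.le_heart _ hW⟩ : t.heart.FullSubcategory) ⟶ ⟨X, hP.le_heart _ hX⟩) := by
      ext
      exact (Category.assoc _ _ _).trans hx
    have h₂ := congrArg InducedCategory.Hom.hom ((cancel_mono _).1 (h₁.trans zero_comp.symm))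
    exact (hc W hW).1 (h₂.trans zero_comp.symm)

/-- The kernel is taken in `P`, as the coreflection of the kernel in the old heart. Since `P`
generates the new heart, exactness and injectivity there can be tested on maps from `P`, where they
hold by the universal property. -/
lemma isResolving (hP : IsTwoTilting t P)
    (h : ∀ X, t.IsLE X 0 → ∃ (Z W : C) (f : Z ⟶ X) (g : X ⟶ W) (δ : W ⟶ Z⟦(1 : ℤ)⟧),
      Triangle.mk f g δ ∈ distTriang C ∧ t.heart Z ∧ tiltAisle t P (W⟦(-1 : ℤ)⟧)) :
    IsResolving (heartInterToRight t hP.tilt) where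
  exists_epi := hP.exists_epi h
  exists_kernel {X Y} f := by
    have hX {W : C} : heartInter t hP.tilt W ↔ P W := by rw [← hP.eq_heartInter]
    obtain ⟨K, k, hK, hk, hk'⟩ := hP.exists_kernel (hX.1 X.property) (hX.1 Y.property) f.hom
    let k₀ : (⟨K, hX.2 hK⟩ : (heartInter t hP.tilt).FullSubcategory) ⟶ X := ObjectProperty.homMk k
    let i := heartInterToRight t hP.tilt
    have w : i.map k₀ ≫ i.map f = 0 := by
      ext
      exact hk
    refine ⟨_, k₀, w, ?_, ?_⟩
    · rw [ShortComplex.exact_iff_epi_kernel_lift]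
      obtain ⟨W, p, _⟩ := hP.exists_epi h (kernel (i.map f))
      have hp : (p ≫ kernel.ι (i.map f)) ≫ i.map f = 0 := by simp
      have hp' := congrArg InducedCategory.Hom.hom hp
      obtain ⟨y, hy⟩ := (hk' W.obj (hX.1 W.property)).1 (p ≫ kernel.ι (i.map f)).hom hp'
      let y' : i.obj W ⟶ i.obj ⟨K, hX.2 hK⟩ := ObjectProperty.homMk y
      have : y' ≫ kernel.lift (i.map f) (i.map k₀) w = p := by
        rw [← cancel_mono (kernel.ι (i.map f)), Category.assoc, kernel.lift_ι]
        ext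
        exact hy
      exact epi_of_epi_fac this
    · rw [Preadditive.mono_iff_cancel_zero]
      intro M m hm
      obtain ⟨W, p, _⟩ := hP.exists_epi h M
      rw [← cancel_epi p, comp_zero]
      ext
      have hp : (p ≫ m) ≫ i.map k₀ = 0 := by rw [Category.assoc, hm, comp_zero]
      have hp' := congrArg InducedCategory.Hom.hom hp
      exact (hk' W.obj (hX.1 W.property)).2 _ hp'

end IsTwoTilting

end

end CategoryTheory.Triangulated

/-! ### Complexes over `E` and the aisle -/

section

open DerivedCategory

variable {A : Type u} [Category.{v} A] [Abelian A] [HasDerivedCategory.{w} A]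
  {E : ObjectProperty A}

/-- The terms in degrees 0 and -1 contribute `E` and `E[1]`; the rest is `≤ -2`. All three lie in
the aisle, which is closed under extensions. -/
lemma tiltAisle_Q_obj (K : CochainComplex A ℤ) [K.IsStrictlyLE 0] [E.IsClosedUnderIsomorphisms]
    (hK : ∀ i ≤ 0, E (K.X i)) : tiltAisle TStructure.t (inDerived E) (Q.obj K) := by
  obtain ⟨W, f, g, h, hT, _, hW⟩ := exists_distinguished_single K 0
  have : W.IsStrictlyLE (-1) := ‹_›
  obtain ⟨W', f', g', h', hT', _, hW'⟩ := exists_distinguished_single W (-1)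
  have : W'.IsStrictlyLE (-2) := ‹_›
  have h₀ : tiltAisle TStructure.t (inDerived E) ((singleFunctor A 0).obj (K.X 0)) :=
    IsTwoTilting.le_tiltAisle _ (inDerived_singleFunctor_obj (hK 0 le_rfl))
  have h₁ : tiltAisle TStructure.t (inDerived E) ((singleFunctor A (-1)).obj (W.X (-1))) := by
    obtain ⟨e⟩ := nonempty_singleFunctor_iso_shift (W.X (-1)) 1 (-1) 0 (by simp)
    refine IsTwoTilting.map_shift_le_tiltAisle _ ⟨_, inDerived_singleFunctor_obj ?_, ⟨e.symm⟩⟩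
    exact E.prop_of_iso (hW (-1) (by simp)).some (hK _ (by simp))
  have h₂ : tiltAisle TStructure.t (inDerived E) (Q.obj W') :=
    IsTwoTilting.le_neg_two_le_tiltAisle _ (TStructure.t.le_of_isLE _ _)
  exact ObjectProperty.ext_of_isTriangulatedClosed₂ _ _ hT h₀
    (ObjectProperty.ext_of_isTriangulatedClosed₂ _ _ hT' h₁ h₂)

namespace IsTwoTiltingTorsionClass

lemma exists_triangle_of_isLE (hE : IsTwoTiltingTorsionClass E) (X : DerivedCategory A)
    (hX : X.IsLE 0) :
    ∃ (Z W : DerivedCategory A) (f : Z ⟶ X) (g : X ⟶ W) (δ : W ⟶ Z⟦(1 : ℤ)⟧),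
      Triangle.mk f g δ ∈ distTriang (DerivedCategory A) ∧ TStructure.t.heart Z ∧
        tiltAisle TStructure.t (inDerived E) (W⟦(-1 : ℤ)⟧) := by
  have := hE.isClosedUnderIsomorphisms
  obtain ⟨L, hL, ⟨e⟩⟩ := hE.exists_complex X
  have : L.IsLE 0 := by rw [← isLE_Q_obj_iff]; exact TStructure.t.isLE_of_iso e 0
  let e₁ : X ≅ Q.obj (L.truncLE 0) := e ≪≫ (asIso (Q.map (L.ιTruncLE 0))).symm
  obtain ⟨W, f, g, h, hT, _, hW⟩ := exists_distinguished_single (L.truncLE 0) 0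
  have : W.IsStrictlyLE (-1) := ‹_›
  have := W.isStrictlyLE_shift (-1) (-1) 0 (by simp)
  refine ⟨_, _, f ≫ e₁.inv, e₁.hom ≫ g, h,
    mk_of_iso hT (Iso.refl _) e₁.symm (Iso.refl _) (by simp) (by simp) (by simp),
    singleFunctor_obj_mem_heart _, ?_⟩
  -- `W` carries the terms in degrees `≤ -1`, which truncation left unchanged in `E`; shifting by -1
  -- moves them to degrees `≤ 0`.
  refine (tiltAisle _ _).prop_of_iso ((Q.commShiftIso (-1 : ℤ)).app W)
    (tiltAisle_Q_obj (W⟦(-1 : ℤ)⟧) fun i hi ↦ ?_)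
  exact E.prop_of_iso ((L.truncLEXIso 0 (i - 1)).symm ≪≫ (hW (i - 1) (by lia)).some ≪≫
    (W.shiftFunctorObjXIso (-1) i (i - 1) (by lia)).symm) (hL _)

lemma isResolving (hE : IsTwoTiltingTorsionClass E) :
    IsResolving (heartInterToRight TStructure.t hE.isTwoTilting.tilt) :=
  hE.isTwoTilting.isResolving hE.exists_triangle_of_isLE

end IsTwoTiltingTorsionClass

end

/-! ### The heart of the natural t-structure and its derived category -/

namespace CategoryTheory

open _root_.DerivedCategory

section

variable {A : Type*} {B : Type*} [Category* A] [Category* B] [Abelian A] [Abelian B]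
  [HasDerivedCategory.{w₁} A] [HasDerivedCategory.{w₂} B]

lemma Functor.isEquivalence_mapDerivedCategory (e : A ≌ B) [e.functor.Additive]
    [PreservesFiniteLimits e.functor] [PreservesFiniteColimits e.functor] :
    e.functor.mapDerivedCategory.IsEquivalence := by
  have : e.inverse.Additive := inferInstance
  let c := ComplexShape.up ℤ
  refine Localization.isEquivalence Q (HomologicalComplex.quasiIso A c) Q
    (HomologicalComplex.quasiIso B c) (e.functor.mapHomologicalComplex c ⋙ Q)
    e.functor.mapDerivedCategory (e.inverse.mapHomologicalComplex c ⋙ Q)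
    e.inverse.mapDerivedCategory ?_ ?_
  · exact Functor.associator _ _ _ ≪≫
      Functor.isoWhiskerLeft _ e.inverse.mapDerivedCategoryFactors ≪≫
      (Functor.associator _ _ _).symm ≪≫
      Functor.isoWhiskerRight (e.mapHomologicalComplex c).unitIso.symm Q ≪≫ Functor.leftUnitor _
  · exact Functor.associator _ _ _ ≪≫
      Functor.isoWhiskerLeft _ e.functor.mapDerivedCategoryFactors ≪≫
      (Functor.associator _ _ _).symm ≪≫
      Functor.isoWhiskerRight (e.mapHomologicalComplex c).counitIso Q ≪≫ Functor.leftUnitor _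

end

variable (A : Type u) [Category.{v} A] [Abelian A] [HasDerivedCategory.{w} A]

/-- The functor from `A` to the heart of the canonical t-structure on `D(A)`. -/
noncomputable def toHeart :
    A ⥤ (TStructure.t : TStructure (DerivedCategory A)).heart.FullSubcategory :=
  ObjectProperty.lift _ (singleFunctor A 0) singleFunctor_obj_mem_heart

/-- The composition of `toHeart A` with the inclusion in `D(A)`. -/
noncomputable def toHeartCompι : toHeart A ⋙ TStructure.t.heart.ι ≅ singleFunctor A 0 :=
  ObjectProperty.liftCompιIso _ _ _

instance : (toHeart A).Full := by unfold toHeart; infer_instance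

instance : (toHeart A).Faithful := by unfold toHeart; infer_instance

instance : (toHeart A).Additive where
  map_add {X Y f g} := by
    ext
    exact (singleFunctor A 0).map_add

instance : (toHeart A).EssSurj where
  mem_essImage X := by
    obtain ⟨Y, ⟨e⟩⟩ := exists_singleFunctor_iso_of_heart X.property
    exact ⟨Y, ⟨ObjectProperty.isoMk _ e⟩⟩

instance : (toHeart A).IsEquivalence where

instance : (toHeart A).asEquivalence.symm.functor.Additive := by
  have : (toHeart A).asEquivalence.functor.Additive := inferInstanceAs (toHeart A).Additive
  exact inferInstanceAs (toHeart A).asEquivalence.inverse.Additive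

variable {A} {E : ObjectProperty A}

lemma exists_iso_toHeart_obj {X : TStructure.t.heart.FullSubcategory}
    (hX : inDerived E X.obj) : ∃ Y, E Y ∧ Nonempty ((toHeart A).obj Y ≅ X) := by
  obtain ⟨Y, hY, ⟨e⟩⟩ := hX
  exact ⟨Y, hY, ⟨ObjectProperty.isoMk _ e⟩⟩

end CategoryTheory

namespace IsTwoTiltingTorsionClass

open DerivedCategory

variable {A : Type u} [Category.{v} A] [Abelian A] [HasDerivedCategory.{w} A]
  {E : ObjectProperty A}

lemma inDerived_cokernel (hE : IsTwoTiltingTorsionClass E)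
    {X Y : (TStructure.t : TStructure (DerivedCategory A)).heart.FullSubcategory}
    (hX : inDerived E X.obj) (hY : inDerived E Y.obj) (f : X ⟶ Y) :
    inDerived E (cokernel f).obj := by
  obtain ⟨x, hx, ⟨a⟩⟩ := exists_iso_toHeart_obj hX
  obtain ⟨y, hy, ⟨b⟩⟩ := exists_iso_toHeart_obj hY
  obtain ⟨f', hf'⟩ := (toHeart A).map_surjective (a.hom ≫ f ≫ b.inv)
  let e : (toHeart A).obj (cokernel f') ≅ cokernel f :=
    PreservesCokernel.iso (toHeart A) f' ≪≫ cokernel.mapIso _ _ a b (by simp [hf'])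
  exact ⟨cokernel f', hE.prop_of_exact_of_epi (ShortComplex.exact_cokernel f')
    (inferInstanceAs (Epi (cokernel.π f'))) hx hy, ⟨(TStructure.t.heart.ι).mapIso e⟩⟩

lemma isCoresolving_heartInterToLeft (hE : IsTwoTiltingTorsionClass E) :
    IsCoresolving (heartInterToLeft TStructure.t hE.isTwoTilting.tilt) where
  exists_mono X := by
    let e := (toHeart A).objObjPreimageIso X
    obtain ⟨y, f, hy, hf⟩ := hE.cogenerates ((toHeart A).objPreimage X)
    refine ⟨⟨((toHeart A).obj y).obj, ?_⟩, e.inv ≫ (toHeart A).map f, mono_comp _ _⟩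
    rw [← hE.isTwoTilting.eq_heartInter]
    exact inDerived_singleFunctor_obj hy
  exists_cokernel {X Y} f := by
    have hX {Z : DerivedCategory A} :
        heartInter TStructure.t hE.isTwoTilting.tilt Z ↔ inDerived E Z := by
      rw [← hE.isTwoTilting.eq_heartInter]
    let i := heartInterToLeft TStructure.t hE.isTwoTilting.tilt
    let Z : (heartInter TStructure.t hE.isTwoTilting.tilt).FullSubcategory :=
      ⟨(cokernel (i.map f)).obj,
        hX.2 (hE.inDerived_cokernel (hX.1 X.property) (hX.1 Y.property) (i.map f))⟩
    let g : Y ⟶ Z := ObjectProperty.homMk (cokernel.π (i.map f)).hom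
    exact ⟨Z, g, cokernel.condition (i.map f), ShortComplex.exact_cokernel (i.map f),
      inferInstanceAs (Epi (cokernel.π (i.map f)))⟩

end IsTwoTiltingTorsionClass

/-- The triangulated equivalence `D(H) ≌ D(A)` for the heart `H` of the canonical t-structure. -/
noncomputable def heartEquivalenceDerivedCategory (A : Type u) [Category.{v} A] [Abelian A]
    [HasDerivedCategory.{w} A] [HasDerivedCategory.{w₁} (DerivedCategory.TStructure.t :
      TStructure (DerivedCategory A)).heart.FullSubcategory] :
    HeartEquivalence (DerivedCategory.TStructure.t : TStructure (DerivedCategory A)) where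
  functor := (toHeart A).asEquivalence.symm.functor.mapDerivedCategory
  commShift := inferInstance
  isTriangulated := inferInstance
  isEquivalence := Functor.isEquivalence_mapDerivedCategory _
  extendsInclusion := Functor.mapDerivedCategorySingleFunctor _ 0 ≪≫
    Functor.isoWhiskerLeft _ (toHeartCompι A).symm ≪≫ (Functor.associator _ _ _).symm ≪≫
    Functor.isoWhiskerRight (toHeart A).asEquivalence.counitIso _ ≪≫ Functor.leftUnitor _

/-! ### Acyclic complexes in the two hearts -/

namespace CategoryTheory

section

variable {E B : Type*} [Category* E] [Preadditive E] [Category* B] [Abelian B]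

/-- A complex in `E` splits along `i : E ⥤ B` into short exact sequences of `B` which consist of
objects of `E`. -/
def IsSplicedAlong (i : E ⥤ B) [i.Additive] (K : CochainComplex E ℤ) : Prop :=
  ∃ (Z : ℤ → E) (p : ∀ n, K.X (n + 1) ⟶ Z n) (j : ∀ n, Z n ⟶ K.X (n + 1 + 1))
    (_ : ∀ n, p n ≫ j n = K.d (n + 1) (n + 1 + 1)) (w : ∀ n, j n ≫ p (n + 1) = 0),
    ∀ n, ((ShortComplex.mk (j n) (p (n + 1)) (w n)).map i).ShortExact

variable {i : E ⥤ B} [i.Additive] {K : CochainComplex E ℤ}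

lemma IsSplicedAlong.acyclic (h : IsSplicedAlong i K) :
    ((i.mapHomologicalComplex (.up ℤ)).obj K).Acyclic := by
  obtain ⟨Z, p, j, hpj, w, hS⟩ := h
  intro m
  -- `Z n` sits between degrees `n + 1` and `n + 2`, so the sequence indexed by `n` controls
  -- exactness in degree `n + 2`. Precomposing with the epi `p n` and postcomposing with the mono `j
  -- (n + 1)` turns it into the pair of differentials.
  obtain ⟨n, rfl⟩ : ∃ n, m = n + 1 + 1 := ⟨m - 1 - 1, by lia⟩
  rw [HomologicalComplex.exactAt_iff' _ (n + 1) (n + 1 + 1) (n + 1 + 1 + 1) (by simp) (by simp)]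
  have hp (k : ℤ) : Epi (i.map (p (k + 1))) := (hS k).epi_g
  have hp' : Epi (i.map (p n)) := by
    obtain ⟨k, rfl⟩ : ∃ k, n = k + 1 := ⟨n - 1, by lia⟩
    exact hp k
  have hj (k : ℤ) : Mono (i.map (j k)) := (hS k).mono_f
  have h₁ : i.map (p n) ≫ i.map (j n) = i.map (K.d (n + 1) (n + 1 + 1)) := by
    rw [← i.map_comp, hpj]
  have h₂ : i.map (p (n + 1)) ≫ i.map (j (n + 1)) =
      i.map (K.d (n + 1 + 1) (n + 1 + 1 + 1)) := by
    rw [← i.map_comp, hpj]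
  have h₃ : i.map (j n) ≫ i.map (p (n + 1)) = 0 := by rw [← i.map_comp, w, i.map_zero]
  let T : ShortComplex B := ShortComplex.mk (i.map (K.d (n + 1) (n + 1 + 1))) (i.map (p (n + 1)))
    (by rw [← h₁, Category.assoc, h₃, comp_zero])
  let T' : ShortComplex B := ShortComplex.mk (i.map (K.d (n + 1) (n + 1 + 1)))
    (i.map (K.d (n + 1 + 1) (n + 1 + 1 + 1))) (by rw [← i.map_comp, K.d_comp_d, i.map_zero])
  let φ : T ⟶ (ShortComplex.mk (j n) (p (n + 1)) (w n)).map i :=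
    { τ₁ := i.map (p n)
      τ₂ := 𝟙 _
      τ₃ := 𝟙 _
      comm₁₂ := h₁.trans (Category.comp_id _).symm
      comm₂₃ := (Category.id_comp _).trans (Category.comp_id _).symm }
  let ψ : T ⟶ T' :=
    { τ₁ := 𝟙 _
      τ₂ := 𝟙 _
      τ₃ := i.map (j (n + 1))
      comm₁₂ := (Category.id_comp _).trans (Category.comp_id _).symm
      comm₂₃ := (Category.id_comp _).trans h₂.symm }
  have : Epi φ.τ₁ := hp'
  have : IsIso φ.τ₂ := inferInstanceAs (IsIso (𝟙 _))
  have : Mono φ.τ₃ := inferInstanceAs (Mono (𝟙 _))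
  have : Epi ψ.τ₁ := inferInstanceAs (Epi (𝟙 _))
  have : IsIso ψ.τ₂ := inferInstanceAs (IsIso (𝟙 _))
  have : Mono ψ.τ₃ := hj (n + 1)
  exact (ShortComplex.exact_iff_of_epi_of_isIso_of_mono ψ).1
    ((ShortComplex.exact_iff_of_epi_of_isIso_of_mono φ).2 (hS n).exact)

variable [i.Full] [i.Faithful]

/-- Take for `Z n` the cokernel of `d n (n + 1)`, which is in `E`. By acyclicity it embeds in the
next term, so it is the image of the next differential. -/
lemma IsCoresolving.isSplicedAlong (hi : IsCoresolving i)
    (hK : ((i.mapHomologicalComplex (.up ℤ)).obj K).Acyclic) : IsSplicedAlong i K := by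
  have hK' (n : ℤ) : (ShortComplex.mk (i.map (K.d n (n + 1))) (i.map (K.d (n + 1) (n + 1 + 1)))
      (by rw [← i.map_comp, K.d_comp_d, i.map_zero])).Exact :=
    (HomologicalComplex.exactAt_iff' _ n (n + 1) (n + 1 + 1) (by simp) (by simp)).1 (hK (n + 1))
  choose Z p w hw hp using fun n ↦ hi.exists_cokernel (K.d n (n + 1))
  have hd (n : ℤ) : i.map (K.d n (n + 1)) ≫ i.map (K.d (n + 1) (n + 1 + 1)) = 0 := by
    rw [← i.map_comp, K.d_comp_d, i.map_zero]
  have hj (n : ℤ) : ∃ j : Z n ⟶ K.X (n + 1 + 1), p n ≫ j = K.d (n + 1) (n + 1 + 1) := by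
    have := hp n
    obtain ⟨j, hj⟩ := i.map_surjective ((hw n).desc (i.map (K.d (n + 1) (n + 1 + 1))) (hd n))
    exact ⟨j, i.map_injective (by rw [i.map_comp, hj]; exact (hw n).g_desc _ _)⟩
  choose j hpj using hj
  have hpj' (n : ℤ) : i.map (p n) ≫ i.map (j n) = i.map (K.d (n + 1) (n + 1 + 1)) := by
    rw [← i.map_comp, hpj]
  have hz (n : ℤ) : j n ≫ p (n + 1) = 0 := i.map_injective (by
    have := hp n
    rw [← cancel_epi (i.map (p n)), i.map_comp, reassoc_of% (hpj' n), w, i.map_zero, comp_zero])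
  refine ⟨Z, p, j, hpj, hz, fun n ↦ ?_⟩
  have : Epi (i.map (p n)) := hp n
  have : Mono (i.map (j n)) := by
    have := (ShortComplex.exact_iff_mono_cokernel_desc _).1 (hK' n)
    dsimp only at this
    let a := (hw n).desc (cokernel.π (i.map (K.d n (n + 1)))) (cokernel.condition _)
    have ha : i.map (p n) ≫ a = cokernel.π (i.map (K.d n (n + 1))) := (hw n).g_desc _ _
    have hab : a ≫ cokernel.desc _ _ (w n) = 𝟙 _ := by
      rw [← cancel_epi (i.map (p n)), reassoc_of% ha, cokernel.π_desc, Category.comp_id]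
    have : Mono a := mono_of_mono_fac hab
    have hac : a ≫ cokernel.desc _ _ (hd n) = i.map (j n) := by
      rw [← cancel_epi (i.map (p n)), reassoc_of% ha, cokernel.π_desc, hpj']
    rw [← hac]
    exact mono_comp _ _
  let T := ShortComplex.mk _ _ (w (n + 1))
  let φ : T ⟶ (ShortComplex.mk (j n) (p (n + 1)) (hz n)).map i :=
    { τ₁ := i.map (p n)
      τ₂ := 𝟙 _
      τ₃ := 𝟙 _
      comm₁₂ := (hpj' n).trans (Category.comp_id _).symm
      comm₂₃ := (Category.id_comp _).trans (Category.comp_id _).symm }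
  have : Epi φ.τ₁ := hp n
  have : IsIso φ.τ₂ := inferInstanceAs (IsIso (𝟙 _))
  have : Mono φ.τ₃ := inferInstanceAs (Mono (𝟙 _))
  exact { exact := (ShortComplex.exact_iff_of_epi_of_isIso_of_mono φ).1 (hw (n + 1))
          mono_f := ‹_›
          epi_g := hp (n + 1) }

/-- Dually, take for `Z n` the kernel of the differential out of degree `n + 2`; by acyclicity the
preceding term maps onto it. -/
lemma IsResolving.isSplicedAlong (hi : IsResolving i)
    (hK : ((i.mapHomologicalComplex (.up ℤ)).obj K).Acyclic) : IsSplicedAlong i K := by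
  have hK' (n : ℤ) : (ShortComplex.mk (i.map (K.d n (n + 1))) (i.map (K.d (n + 1) (n + 1 + 1)))
      (by rw [← i.map_comp, K.d_comp_d, i.map_zero])).Exact :=
    (HomologicalComplex.exactAt_iff' _ n (n + 1) (n + 1 + 1) (by simp) (by simp)).1 (hK (n + 1))
  choose Z j w hw hj using fun n ↦ hi.exists_kernel (K.d (n + 1 + 1) (n + 1 + 1 + 1))
  have hd (n : ℤ) : i.map (K.d n (n + 1)) ≫ i.map (K.d (n + 1) (n + 1 + 1)) = 0 := by
    rw [← i.map_comp, K.d_comp_d, i.map_zero]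
  have hp (n : ℤ) : ∃ p : K.X (n + 1) ⟶ Z n, p ≫ j n = K.d (n + 1) (n + 1 + 1) := by
    have := hj n
    obtain ⟨p, hp⟩ := i.map_surjective ((hw n).lift (i.map (K.d (n + 1) (n + 1 + 1))) (hd (n + 1)))
    exact ⟨p, i.map_injective (by rw [i.map_comp, hp]; exact (hw n).lift_f _ _)⟩
  choose p hpj using hp
  have hpj' (n : ℤ) : i.map (p n) ≫ i.map (j n) = i.map (K.d (n + 1) (n + 1 + 1)) := by
    rw [← i.map_comp, hpj]
  have hz (n : ℤ) : j n ≫ p (n + 1) = 0 := i.map_injective (by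
    have := hj (n + 1)
    rw [← cancel_mono (i.map (j (n + 1))), i.map_comp, Category.assoc, hpj', w, i.map_zero,
      zero_comp])
  refine ⟨Z, p, j, hpj, hz, fun n ↦ ?_⟩
  have : Mono (i.map (j (n + 1))) := hj (n + 1)
  have : Epi (i.map (p (n + 1))) := by
    have := (ShortComplex.exact_iff_epi_kernel_lift _).1 (hK' (n + 1 + 1))
    dsimp only at this
    let a := (hw (n + 1)).lift (kernel.ι (i.map (K.d (n + 1 + 1 + 1) (n + 1 + 1 + 1 + 1))))
      (kernel.condition _)
    have ha : a ≫ i.map (j (n + 1)) =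
      kernel.ι (i.map (K.d (n + 1 + 1 + 1) (n + 1 + 1 + 1 + 1))) := (hw (n + 1)).lift_f _ _
    have hab : kernel.lift _ _ (w (n + 1)) ≫ a = 𝟙 _ := by
      rw [← cancel_mono (i.map (j (n + 1))), Category.assoc, ha, kernel.lift_ι, Category.id_comp]
    have : Epi a := epi_of_epi_fac hab
    have hac : kernel.lift _ _ (hd (n + 1 + 1)) ≫ a = i.map (p (n + 1)) := by
      rw [← cancel_mono (i.map (j (n + 1))), Category.assoc, ha, kernel.lift_ι, hpj']
    rw [← hac]
    exact epi_comp _ _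
  let T := ShortComplex.mk _ _ (w n)
  let φ : (ShortComplex.mk (j n) (p (n + 1)) (hz n)).map i ⟶ T :=
    { τ₁ := 𝟙 _
      τ₂ := 𝟙 _
      τ₃ := i.map (j (n + 1))
      comm₁₂ := (Category.id_comp _).trans (Category.comp_id _).symm
      comm₂₃ := (Category.id_comp _).trans (hpj' (n + 1)).symm }
  have : Epi φ.τ₁ := inferInstanceAs (Epi (𝟙 _))
  have : IsIso φ.τ₂ := inferInstanceAs (IsIso (𝟙 _))
  have : Mono φ.τ₃ := hj (n + 1)
  exact { exact := (ShortComplex.exact_iff_of_epi_of_isIso_of_mono φ).2 (hw n)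
          mono_f := hj n
          epi_g := ‹_› }

end

/-- On either side acyclic means spliced from short exact sequences with terms in `E`: one side uses
cokernels, the other kernels. So only the short exact sequences within `E` have to agree. -/
lemma acyclicAlong_eq {E B₁ B₂ : Type*} [Category* E] [Preadditive E] [Category* B₁] [Abelian B₁]
    [Category* B₂] [Abelian B₂] {i₁ : E ⥤ B₁} {i₂ : E ⥤ B₂} [i₁.Additive] [i₂.Additive]
    [i₁.Full] [i₁.Faithful] [i₂.Full] [i₂.Faithful] (h₁ : IsCoresolving i₁) (h₂ : IsResolving i₂)
    (h : ∀ S : ShortComplex E, (S.map i₁).ShortExact ↔ (S.map i₂).ShortExact) :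
    acyclicAlong i₁ = acyclicAlong i₂ := by
  ext K
  obtain ⟨K, rfl⟩ := HomotopyCategory.quotient_obj_surjective K
  have h₃ : acyclicAlong i₁ ((HomotopyCategory.quotient _ _).obj K) ↔
      ((i₁.mapHomologicalComplex (.up ℤ)).obj K).Acyclic :=
    HomotopyCategory.quotient_obj_mem_subcategoryAcyclic_iff_acyclic _
  have h₄ : acyclicAlong i₂ ((HomotopyCategory.quotient _ _).obj K) ↔
      ((i₂.mapHomologicalComplex (.up ℤ)).obj K).Acyclic :=
    HomotopyCategory.quotient_obj_mem_subcategoryAcyclic_iff_acyclic _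
  have h₅ : IsSplicedAlong i₁ K ↔ IsSplicedAlong i₂ K := by simp only [IsSplicedAlong, h]
  rw [h₃, h₄]
  exact ⟨fun hK ↦ (h₅.1 (h₁.isSplicedAlong hK)).acyclic,
    fun hK ↦ (h₅.2 (h₂.isSplicedAlong hK)).acyclic⟩

section

variable {C : Type u} [Category.{v} C] [Preadditive C] [HasZeroObject C] [HasShift C ℤ]
  [∀ n : ℤ, (shiftFunctor C n).Additive] [Pretriangulated C] [CategoryTheory.IsTriangulated C]

/-- A sequence in the heart is short exact iff it extends to a distinguished triangle. -/
lemma heart_shortExact_iff (t : TStructure C) (S : ShortComplex t.heart.FullSubcategory) :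
    S.ShortExact ↔ ∃ δ, Triangle.mk S.f.hom S.g.hom δ ∈ distTriang C := by
  refine ⟨fun hS ↦ exists_distinguished_of_shortExact (ι := t.heart.ι) (heart_hom_eq_zero t)
    (heart_admissibleMorphism t) hS, fun ⟨δ, hδ⟩ ↦ ?_⟩
  obtain ⟨_, h⟩ := shortExact_of_distinguished (ι := t.heart.ι) (heart_hom_eq_zero t) hδ
  exact h

instance (D T : TStructure C) : (heartInterToLeft D T).Full where
  map_surjective f := ⟨ObjectProperty.homMk f.hom, rfl⟩

instance (D T : TStructure C) : (heartInterToRight D T).Full where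
  map_surjective f := ⟨ObjectProperty.homMk f.hom, rfl⟩

instance (D T : TStructure C) : (heartInterToLeft D T).Faithful where
  map_injective h := by
    have h' := congrArg InducedCategory.Hom.hom h
    exact ObjectProperty.hom_ext _ h'

instance (D T : TStructure C) : (heartInterToRight D T).Faithful where
  map_injective h := by
    have h' := congrArg InducedCategory.Hom.hom h
    exact ObjectProperty.hom_ext _ h'

lemma acyclicAlong_heartInter_eq {D T : TStructure C} (h₁ : IsCoresolving (heartInterToLeft D T))
    (h₂ : IsResolving (heartInterToRight D T)) :
    acyclicAlong (heartInterToLeft D T) = acyclicAlong (heartInterToRight D T) :=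
  acyclicAlong_eq h₁ h₂ fun S ↦ by
    have h₃ : (S.map (heartInterToLeft D T)).ShortExact ↔
      ∃ δ, Triangle.mk S.f.hom S.g.hom δ ∈ distTriang C := heart_shortExact_iff D _
    have h₄ : (S.map (heartInterToRight D T)).ShortExact ↔
      ∃ δ, Triangle.mk S.f.hom S.g.hom δ ∈ distTriang C := heart_shortExact_iff T _
    rw [h₃, h₄]

end

end CategoryTheory

/-! ### The derived category of the tilted heart -/

namespace CategoryTheory

section

variable {K D₁ D₂ : Type*} [Category* K] [Category* D₁] [Category* D₂]
  [HasShift K ℤ] [HasShift D₁ ℤ] [HasShift D₂ ℤ]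
  [HasZeroObject K] [HasZeroObject D₁] [HasZeroObject D₂]
  [Preadditive K] [Preadditive D₁] [Preadditive D₂]
  [∀ (n : ℤ), (shiftFunctor K n).Additive] [∀ (n : ℤ), (shiftFunctor D₁ n).Additive]
  [∀ (n : ℤ), (shiftFunctor D₂ n).Additive]
  [Pretriangulated K] [Pretriangulated D₁] [Pretriangulated D₂] [CategoryTheory.IsTriangulated K]

/-- Two triangulated localization functors for the same class of morphisms are related by a
triangulated equivalence. -/
lemma exists_triangulated_equivalence (N : ObjectProperty K) [N.IsTriangulated]
    (L : K ⥤ D₁) (M : K ⥤ D₂) [L.CommShift ℤ] [M.CommShift ℤ] [L.IsTriangulated]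
    [M.IsTriangulated] [L.IsLocalization N.trW] [M.IsLocalization N.trW] :
    ∃ (G : D₁ ⥤ D₂) (_ : G.CommShift ℤ), G.IsTriangulated ∧ G.IsEquivalence ∧
      Nonempty (L ⋙ G ≅ M) := by
  let G := (Localization.uniq L M N.trW).functor
  let _ : G.CommShift ℤ := Functor.commShiftOfLocalization L N.trW ℤ M G
  have : L.mapArrow.EssSurj := Localization.essSurj_mapArrow L N.trW
  have : NatTrans.CommShift (Localization.Lifting.iso L N.trW M G).hom ℤ := inferInstance
  exact ⟨G, inferInstance,
    Functor.isTriangulated_of_precomp_iso (Localization.Lifting.iso L N.trW M G), inferInstance,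
    ⟨Localization.Lifting.iso L N.trW M G⟩⟩

end

section

variable {E : Type*} {B : Type u} [Category* E] [Category.{v} B] [Preadditive E] [Abelian B]
  [HasDerivedCategory.{w} B] (i : E ⥤ B) [i.Additive]

noncomputable instance : (homotopyToDerived i).CommShift ℤ := by
  unfold homotopyToDerived; infer_instance

/-- The objects of `E` as complexes concentrated in degree `0`. -/
noncomputable def singleHomotopyToDerivedIso [HasZeroObject E] :
    (HomologicalComplex.single E (.up ℤ) 0 ⋙ HomotopyCategory.quotient E (.up ℤ)) ⋙
      homotopyToDerived i ≅ i ⋙ DerivedCategory.singleFunctor B 0 :=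
  Functor.associator _ _ _ ≪≫
    Functor.isoWhiskerLeft _ (Functor.isoWhiskerRight
      (i.mapHomotopyCategoryFactors (.up ℤ)) DerivedCategory.Qh) ≪≫
    Functor.isoWhiskerLeft _ (Functor.isoWhiskerLeft (i.mapHomologicalComplex (.up ℤ))
      (DerivedCategory.quotientCompQhIso B)) ≪≫
    Functor.isoWhiskerRight (HomologicalComplex.singleMapHomologicalComplex i (.up ℤ) 0)
      DerivedCategory.Q ≪≫
    Functor.isoWhiskerLeft i (DerivedCategory.singleFunctorIsoCompQ B 0).symm

variable [HasZeroObject E] [HasBinaryBiproducts E]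

instance : (homotopyToDerived i).IsTriangulated := by
  unfold homotopyToDerived; infer_instance

instance : (acyclicAlong i).IsTriangulated := by
  unfold acyclicAlong; infer_instance

end

section

variable {C : Type u} [Category.{v} C] [Preadditive C] [HasZeroObject C] [HasShift C ℤ]
  [∀ n : ℤ, (shiftFunctor C n).Additive] [Pretriangulated C] [CategoryTheory.IsTriangulated C]
  {t : TStructure C}

/-- The cone of `u` is `N[1]` with `N` in the heart, and `N[1]` has no nonzero map to an object `≥
0`. Thus `V` need not lie in the heart, which is required for the values of `j`. -/
lemma heart_epi_cancel_zero {X Y : t.heart.FullSubcategory} (u : X ⟶ Y) [Epi u] {V : C}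
    (hV : t.IsGE V 0) (a : Y.obj ⟶ V) (ha : u.hom ≫ a = 0) : a = 0 := by
  obtain ⟨N, k, δ, hT⟩ := AbelianSubcategory.exists_distinguished_triangle_of_epi
    (heart_hom_eq_zero t) (heart_admissibleMorphism t) u
  obtain ⟨b, hb⟩ := mk_yoneda₃ hT a ha
  have : t.IsLE (t.heart.ι.obj N) 0 := ((t.mem_heart_iff _).1 N.property).1
  have := t.isLE_shift (t.heart.ι.obj N) 0 1 (-1)
  rw [hb, show b = 0 from t.zero b (-1) 0, comp_zero]

variable {E : Type*} [Category* E] [Preadditive E]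
  {i : E ⥤ t.heart.FullSubcategory} [i.Additive] [i.Full] {j : t.heart.FullSubcategory ⥤ C}

section

variable (η : i ⋙ t.heart.ι ≅ i ⋙ j)
  (hj : ∀ S : ShortComplex t.heart.FullSubcategory, S.ShortExact →
    ∃ δ : j.obj S.X₃ ⟶ (j.obj S.X₁)⟦(1 : ℤ)⟧,
      Triangle.mk (j.map S.f) (j.map S.g) δ ∈ distTriang C)

omit [Preadditive E] [i.Additive] [i.Full] in
include hj in
lemma exists_iso_of_shortExact {e : E} {N X : t.heart.FullSubcategory} (k : N ⟶ i.obj e)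
    (x : i.obj e ⟶ X) (w : k ≫ x = 0) (hS : (ShortComplex.mk k x w).ShortExact)
    (β : N.obj ≅ j.obj N) (hβ : k.hom ≫ η.hom.app e = β.hom ≫ j.map k) :
    ∃ α : X.obj ≅ j.obj X, x.hom ≫ α.hom = η.hom.app e ≫ j.map x := by
  obtain ⟨δ, hδ⟩ := (heart_shortExact_iff t _).1 hS
  obtain ⟨δ', hδ'⟩ := hj _ hS
  obtain ⟨α, hα, hα'⟩ := complete_distinguished_triangle_morphism _ _ hδ hδ'
    β.hom (η.hom.app e) hβ
  let φ : Triangle.mk k.hom x.hom δ ⟶ Triangle.mk (j.map k) (j.map x) δ' :=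
    { hom₁ := β.hom
      hom₂ := η.hom.app e
      hom₃ := α
      comm₁ := hβ
      comm₂ := hα
      comm₃ := hα' }
  have h₁ : IsIso φ.hom₁ := inferInstanceAs (IsIso β.hom)
  have h₂ : IsIso φ.hom₂ := inferInstanceAs (IsIso (η.hom.app e))
  let α' : X.obj ⟶ j.obj X := α
  have : IsIso α' := isIso₃_of_isIso₁₂ φ hδ hδ' h₁ h₂
  exact ⟨asIso α', hα⟩

omit [CategoryTheory.IsTriangulated C] [Preadditive E] [i.Additive] in
lemma hom_comp_app (e : E) (e' : E) (y : i.obj e ⟶ i.obj e') :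
    y.hom ≫ η.hom.app e' = η.hom.app e ≫ j.map y := by
  obtain ⟨y, rfl⟩ := i.map_surjective y
  exact η.hom.naturality y

include hj in
-- A two-step resolution `e₂ ⟶ e₁ ⟶ e₀` of `X` is used: comparing triangles extends `η` first to the
-- kernel of `e₀ ⟶ X`, then to `X`.
lemma exists_epi_iso (hi : IsResolving i) (X : t.heart.FullSubcategory) :
    ∃ (e : E) (x : i.obj e ⟶ X) (α : X.obj ≅ j.obj X), Epi x ∧
      x.hom ≫ α.hom = η.hom.app e ≫ j.map x := by
  obtain ⟨e₀, x, _⟩ := hi.exists_epi X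
  obtain ⟨e₁, y, _⟩ := hi.exists_epi (kernel x)
  obtain ⟨f, hf⟩ := i.map_surjective (y ≫ kernel.ι x)
  obtain ⟨e₂, g, w, hg, _⟩ := hi.exists_kernel f
  have w' : i.map g ≫ y = 0 := by
    rw [← cancel_mono (kernel.ι x), Category.assoc, ← hf, w, zero_comp]
  have hS : (ShortComplex.mk (i.map g) y w').ShortExact :=
    { exact := by
        let φ : ShortComplex.mk _ _ w' ⟶ ShortComplex.mk _ _ w :=
          { τ₁ := 𝟙 _
            τ₂ := 𝟙 _
            τ₃ := kernel.ι x
            comm₁₂ := (Category.id_comp _).trans (Category.comp_id _).symm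
            comm₂₃ := (Category.id_comp _).trans hf }
        have : Epi φ.τ₁ := inferInstanceAs (Epi (𝟙 _))
        have : IsIso φ.τ₂ := inferInstanceAs (IsIso (𝟙 _))
        have : Mono φ.τ₃ := inferInstanceAs (Mono (kernel.ι x))
        exact (ShortComplex.exact_iff_of_epi_of_isIso_of_mono φ).2 hg }
  obtain ⟨β, hβ⟩ := exists_iso_of_shortExact η hj _ _ w' hS (η.app e₂) (hom_comp_app η _ _ _)
  have hV : t.IsGE (j.obj (i.obj e₀)) 0 := by
    have : t.IsGE (i.obj e₀).obj 0 := ((t.mem_heart_iff _).1 (i.obj e₀).property).2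
    let b : (i.obj e₀).obj ≅ j.obj (i.obj e₀) := η.app e₀
    exact t.isGE_of_iso b 0
  -- The square commutes after precomposition with the epi `y`, by naturality of `η` on `E`; `y` can
  -- be cancelled because the target is `≥ 0`.
  have hβ' : (kernel.ι x).hom ≫ η.hom.app e₀ = β.hom ≫ j.map (kernel.ι x) := by
    rw [← sub_eq_zero]
    refine heart_epi_cancel_zero y hV _ ?_
    have h₁ := hom_comp_app η e₁ e₀ (y ≫ kernel.ι x)
    have h₂ : y.hom ≫ (kernel.ι x).hom ≫ η.hom.app e₀ =
      η.hom.app e₁ ≫ j.map y ≫ j.map (kernel.ι x) := by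
      rw [← Functor.map_comp, ← h₁]
      exact (Category.assoc _ _ _).symm
    rw [Preadditive.comp_sub, sub_eq_zero, h₂, ← Category.assoc, ← hβ, Category.assoc]
  have hx : (ShortComplex.mk (kernel.ι x) x (kernel.condition x)).ShortExact :=
    { exact := ShortComplex.exact_kernel x }
  obtain ⟨α, hα⟩ := exists_iso_of_shortExact η hj _ _ _ hx β hβ'
  exact ⟨e₀, x, α, ‹_›, hα⟩

include η hj in
/-- If `i : E ⥤ H` is resolving for the heart `H` of a t-structure, two functors from `H` which send
short exact sequences to triangles are isomorphic if they are isomorphic on `E`, when the first one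
is the inclusion of `H`. -/
lemma nonempty_heart_iso (hi : IsResolving i) : Nonempty (j ≅ t.heart.ι) := by
  choose e x α hx hα using exists_epi_iso η hj hi
  have hV (X : t.heart.FullSubcategory) : t.IsGE (j.obj X) 0 := by
    have : t.IsGE X.obj 0 := ((t.mem_heart_iff _).1 X.property).2
    exact t.isGE_of_iso (α X) 0
  have cancel {X Y : t.heart.FullSubcategory} (u : X ⟶ Y) (_ : Epi u) {Z : t.heart.FullSubcategory}
      (a b : Y.obj ⟶ j.obj Z) (h : u.hom ≫ a = u.hom ≫ b) : a = b := by
    rw [← sub_eq_zero]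
    exact heart_epi_cancel_zero u (hV Z) _ (by rw [Preadditive.comp_sub, h, sub_self])
  have hα' {Y : t.heart.FullSubcategory} {e' : E} (z : i.obj e' ⟶ Y) :
      z.hom ≫ (α Y).hom = η.hom.app e' ≫ j.map z := by
    have := hx Y
    -- `α Y` was built from one cover `x Y`. To compare with another map `z` from `E`, cover their
    -- pullback by an object of `E` and use naturality of `η` there.
    obtain ⟨e'', r, _⟩ := hi.exists_epi (pullback z (x Y))
    let a : i.obj e'' ⟶ i.obj e' := r ≫ pullback.fst z (x Y)
    let b : i.obj e'' ⟶ i.obj (e Y) := r ≫ pullback.snd z (x Y)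
    have hab : a ≫ z = b ≫ x Y := by simp only [a, b, Category.assoc, pullback.condition]
    have hab' : a.hom ≫ z.hom = b.hom ≫ (x Y).hom := congrArg InducedCategory.Hom.hom hab
    refine cancel a (epi_comp _ _) _ _ ?_
    rw [← Category.assoc, hab', Category.assoc, hα, ← Category.assoc, hom_comp_app, Category.assoc,
      ← Functor.map_comp, ← hab, Functor.map_comp, ← Category.assoc, ← hom_comp_app, Category.assoc]
  refine ⟨(NatIso.ofComponents (F := t.heart.ι) (G := j) α fun {X Y} f ↦ ?_).symm⟩
  refine cancel (x X) (hx X) _ _ ?_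
  have h := hα' (x X ≫ f)
  have h' : (x X).hom ≫ f.hom ≫ (α Y).hom = (η.hom.app (e X) ≫ j.map (x X)) ≫ j.map f := by
    rw [Category.assoc, ← Functor.map_comp, ← h]
    exact (Category.assoc _ _ _).symm
  exact h'.trans ((congrArg (· ≫ j.map f) (hα X).symm).trans (Category.assoc _ _ _))

end

end

end CategoryTheory

section

variable {C : Type u} [Category.{v} C] [Preadditive C] [HasZeroObject C] [HasShift C ℤ]
  [∀ n : ℤ, (shiftFunctor C n).Additive] [Pretriangulated C] [CategoryTheory.IsTriangulated C]

/-- If `D(H_D) ≌ C` extends the inclusion of `H_D`, there is a compatible equivalence for `H_T`. -/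
lemma exists_heartEquivalence {D T : TStructure C}
    [HasDerivedCategory.{w₁} D.heart.FullSubcategory]
    [HasDerivedCategory.{w₂} T.heart.FullSubcategory]
    (hD : IsCoresolving (heartInterToLeft D T)) (hT : IsResolving (heartInterToRight D T))
    (F : HeartEquivalence D) :
    ∃ G : HeartEquivalence T, Nonempty (homotopyToDerived (heartInterToLeft D T) ⋙ F.functor ≅
      homotopyToDerived (heartInterToRight D T) ⋙ G.functor) := by
  let _ := F.commShift
  have := F.isTriangulated
  have := F.isEquivalence
  let iD := heartInterToLeft D T
  let iT := heartInterToRight D T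
  have hL : (homotopyToDerived iD).IsLocalization (acyclicAlong iT).trW := by
    rw [← acyclicAlong_heartInter_eq hD hT]
    exact hD.isLocalization_homotopyToDerived
  have := hT.isLocalization_homotopyToDerived
  have hM : (homotopyToDerived iD ⋙ F.functor).IsLocalization (acyclicAlong iT).trW := inferInstance
  -- Both functors from `K(E)` are localizations for the same null system, so `G` is obtained from
  -- the universal property. This fixes it only on complexes over `E`; `η` records that there it
  -- extends the inclusion.
  obtain ⟨G, _, _, _, ⟨e⟩⟩ := exists_triangulated_equivalence (acyclicAlong iT)
    (homotopyToDerived iT) (homotopyToDerived iD ⋙ F.functor)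
  let s := HomologicalComplex.single (heartInter D T).FullSubcategory (.up ℤ) 0 ⋙
    HomotopyCategory.quotient _ (.up ℤ)
  let η : iT ⋙ T.heart.ι ≅ iT ⋙ DerivedCategory.singleFunctor _ 0 ⋙ G :=
    (Functor.isoWhiskerLeft iD F.extendsInclusion).symm ≪≫
      Functor.isoWhiskerRight (singleHomotopyToDerivedIso iD).symm F.functor ≪≫
      Functor.isoWhiskerLeft s e.symm ≪≫
      Functor.isoWhiskerRight (singleHomotopyToDerivedIso iT) G
  obtain ⟨φ⟩ := nonempty_heart_iso η
    (fun S hS ↦ ⟨_, G.map_distinguished _ hS.singleTriangle_distinguished⟩) hT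
  exact ⟨⟨G, ‹_›, ‹_›, ‹_›, φ⟩, ⟨e.symm⟩⟩

end

theorem theoremT {A : Type u} [Category.{v} A] [Abelian A] [HasDerivedCategory.{w} A]
    [HasDerivedCategory.{w₁}
      (DerivedCategory.TStructure.t : TStructure (DerivedCategory A)).heart.FullSubcategory]
    (E : ObjectProperty A) (hE : IsTwoTiltingTorsionClass E) :
    ∃ T : TStructure (DerivedCategory A),
      T.le 0 = ((DerivedCategory.TStructure.t.le (-2)).extensionProduct
        (inDerived E)).extensionProduct
          ((inDerived E).map (shiftFunctor (DerivedCategory A) (1 : ℤ))) ∧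
      inDerived E = heartInter DerivedCategory.TStructure.t T ∧
      ∀ [HasDerivedCategory.{w₂} T.heart.FullSubcategory],
        IsTiltingPair 2 DerivedCategory.TStructure.t T := by
  have hP := hE.isTwoTilting
  have hD := hE.isCoresolving_heartInterToLeft
  have hT := hE.isResolving
  refine ⟨hP.tilt, hP.tilt_le_zero, hP.eq_heartInter, ?_⟩
  intro _
  obtain ⟨G, hG⟩ := exists_heartEquivalence hD hT (heartEquivalenceDerivedCategory A)
  exact
    { le_neg_le := hP.le_neg_two_le_tilt_le_zero
      le_zero_le := hP.tilt_le_zero_le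
      cogenerates := hD.exists_mono
      generates := hT.exists_epi
      acyclic_iff := acyclicAlong_heartInter_eq hD hT
      isLocalization_left := hD.isLocalization_homotopyToDerived
      isLocalization_right := hT.isLocalization_homotopyToDerived
      exists_equivalences := ⟨_, G, hG⟩ }
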